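/- Notation. Let $\mathbb D$ be the open unit disc in $\mathbb C$ and $\mathbb T$ the unit circle with normalized arc length measure $\sigma$. View $\mathbb C^n$ as the set of points $[z_0,\dots,z_n]\in\mathbb P^n$ with $z_0\neq 0$ (so $z\in\mathbb C^n$ is $[1,z_1,\dots,z_n]$), let $H_\infty=\{z_0=0\}$, and let $\pi:\mathbb C^{n+1}\setminus\{0\}\to\mathbb P^n$ be the projection. A lifting of a holomorphic map $f:\mathbb D\to\mathbb P^n$ is a holomorphic map $\tilde f=(f_0,\dots,f_n):\mathbb D\to\mathbb C^{n+1}\setminus\{0\}$ with $\pi\circ\tilde f=f$. Put $$J(f)=-\sum_{\zeta\in f^{-1}(H_\infty)}m_f(\zeta)\log|\zeta|\in[0,\infty],$$ where $m_f(\zeta)$ is the order of the zero at $\zeta$ of the zeroth component of a holomorphic lifting of $f$ near $\zeta$ (with $-\log 0=\infty$, and $J(f)=\infty$ if $f(\mathbb D)\subset H_\infty$). For $X\subset\mathbb C^n$, the Siciak-Zahariuta extremal function $V_X$ is the pointwise supremum of all plurisubharmonic functions $u$ on $\mathbb C^n$ such that $u-\log^+\|\cdot\|$ is bounded above on $\mathbb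 C^n$ and $u\leq 0$ on $X$. Blaschke products may be finite (possibly constant) or infinite and may include a unimodular constant factor. Proposition 2.1. Let $X$ be a nonempty bounded open subset of $\mathbb C^n$. Let $f:\mathbb D\to\mathbb P^n$ be a holomorphic map with $J(f)<\infty$ that has a lifting $\tilde f=(f_0,\dots,f_n):\mathbb D\to\mathbb C^{n+1}\setminus\{0\}$ such that $f_0,\dots,f_n$ have nontangential limits at almost every point of $\mathbb T$ and such that, for $\sigma$-almost every $\zeta\in\mathbb T$, the vector $\tilde f^*(\zeta)$ of these limits is nonzero and $\pi(\tilde f^*(\zeta))\in X$. Then the following are equivalent. (i) For every holomorphic automorphism $\alpha$ of $\mathbb D$ with $f(\alpha(0))\in\mathbb C^n$, $$V_X(f(\alpha(0)))\leq J(f\circ\alpha).$$ (ii) If $(B,g_1,\dots,g_n)$ is a lifting of $f$ whose zeroth component $B$ is a Blaschke product, then $g_1,\dots,g_n$ are bounded on $\mathbb D$. -/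

import Mathlib

open scoped ENNReal LinearAlgebra.Projectivization

noncomputable section

namespace DiscFormula

/-! ### The unit circle, extended integrals, the extremal function -/

/-- The normalized arc length measure on the unit circle, as a measure on `ℂ` carried by it. -/
def arcLength : MeasureTheory.Measure ℂ :=
  (ENNReal.ofReal (2 * Real.pi))⁻¹ •
    (MeasureTheory.volume.restrict (Set.Ioc 0 (2 * Real.pi))).map (circleMap 0 1)

/-- The mean over the unit circle of an extended real function: the integral of the positive part
minus the integral of the negative part. It is only applied to functions bounded above on
the circle, for which the first integral is finite and the value lies in `[-∞, ∞)`. -/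
def circleMean (g : ℂ → EReal) : EReal :=
  ((∫⁻ ζ, (g ζ).toENNReal ∂arcLength : ℝ≥0∞) : EReal) -
    ((∫⁻ ζ, (-g ζ).toENNReal ∂arcLength : ℝ≥0∞) : EReal)

/-- Plurisubharmonic functions `ℂⁿ → [-∞, ∞)`: upper semicontinuous functions that have the
sub-mean value property on every circle in every complex line. (The constant `-∞` is allowed.) -/
structure Plurisubharmonic {n : ℕ} (u : EuclideanSpace ℂ (Fin n) → EReal) : Prop where
  upperSemicontinuous : UpperSemicontinuous u
  ne_top : ∀ z, u z ≠ ⊤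
  submean : ∀ a b : EuclideanSpace ℂ (Fin n), u a ≤ circleMean fun ζ => u (a + ζ • b)

/-- The Lelong class: entire plurisubharmonic functions `u` such that `u - log⁺ ‖·‖` is bounded
above. -/
def LelongClass (n : ℕ) : Set (EuclideanSpace ℂ (Fin n) → EReal) :=
  {u | Plurisubharmonic u ∧ ∃ C : ℝ, ∀ z, u z ≤ ((Real.posLog ‖z‖ + C : ℝ) : EReal)}

/-- The Siciak-Zahariuta extremal function of `X ⊆ ℂⁿ`. -/
def extremalFunction {n : ℕ} (X : Set (EuclideanSpace ℂ (Fin n)))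
    (z : EuclideanSpace ℂ (Fin n)) : EReal :=
  ⨆ u ∈ {u ∈ LelongClass n | ∀ x ∈ X, u x ≤ 0}, u z

/-! ### Analytic discs in projective space

The open unit disc is `Metric.ball (0 : ℂ) 1`. A map on the disc is represented by a function on
`ℂ`; nothing below depends on its values off the disc. -/

/-- The homogeneous coordinates `(1, z₁, …, zₙ)` of a point of `ℂⁿ`. -/
def homogenize {n : ℕ} (z : EuclideanSpace ℂ (Fin n)) : Fin (n + 1) → ℂ :=
  Fin.cons 1 (fun j => z j)

theorem homogenize_ne_zero {n : ℕ} (z : EuclideanSpace ℂ (Fin n)) : homogenize z ≠ 0 :=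
  fun h => one_ne_zero (congrFun h 0)

/-- The inclusion of `ℂⁿ` in `ℙⁿ`, whose image is the set of points with `z₀ ≠ 0`. -/
def affinePoint {n : ℕ} (z : EuclideanSpace ℂ (Fin n)) : ℙ ℂ (Fin (n + 1) → ℂ) :=
  Projectivization.mk ℂ (homogenize z) (homogenize_ne_zero z)

/-- `F` is, on the open set `U`, a holomorphic lifting of `f` to `ℂⁿ⁺¹ ∖ {0}`. -/
def IsLiftingOn {n : ℕ} (U : Set ℂ) (F : ℂ → Fin (n + 1) → ℂ)
    (f : ℂ → ℙ ℂ (Fin (n + 1) → ℂ)) : Prop :=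
  DifferentiableOn ℂ F U ∧ ∀ z ∈ U, ∃ h : F z ≠ 0, f z = Projectivization.mk ℂ (F z) h

/-- `f` is holomorphic on the unit disc as a map into `ℙⁿ`: it has holomorphic liftings locally. -/
def IsAnalyticDisc {n : ℕ} (f : ℂ → ℙ ℂ (Fin (n + 1) → ℂ)) : Prop :=
  ∀ ζ ∈ Metric.ball (0 : ℂ) 1, ∃ U : Set ℂ, IsOpen U ∧ ζ ∈ U ∧ ∃ F, IsLiftingOn U F f

/-- The multiplicity at `ζ` of the intersection of `f` with the hyperplane at infinity `z₀ = 0`: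
the order at `ζ` of the zeroth component of a holomorphic lifting of `f` near `ζ`. The order is the
same for all such liftings, so the supremum is over a single value. It is `∞` if the zeroth
component vanishes identically near `ζ`. -/
def multAtInfinity {n : ℕ} (f : ℂ → ℙ ℂ (Fin (n + 1) → ℂ)) (ζ : ℂ) : ℕ∞ :=
  ⨆ (U : Set ℂ) (F : ℂ → Fin (n + 1) → ℂ) (_ : IsOpen U ∧ ζ ∈ U ∧ IsLiftingOn U F f),
    analyticOrderAt (fun z => F z 0) ζ

/-- The disc functional `J(f) = -∑ m_f(ζ) log |ζ|`, with values in `[0, ∞]`. Here `-log |0| = ∞`, and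
points with `m_f(ζ) = 0` contribute `0`. It is `∞` if `f` maps the disc into the hyperplane at
infinity, as then all multiplicities are `∞`. -/
def J {n : ℕ} (f : ℂ → ℙ ℂ (Fin (n + 1) → ℂ)) : ℝ≥0∞ :=
  ∑' ζ : Metric.ball (0 : ℂ) 1,
    (multAtInfinity f ζ : ℝ≥0∞) * (-ENNReal.log ‖(ζ : ℂ)‖ₑ).toENNReal

/-! ### Boundary values -/

/-- The nontangential approach region of aperture `M` at the point `ζ` of the unit circle. -/
def approachRegion (ζ : ℂ) (M : ℝ) : Set ℂ :=
  {z | ‖z‖ < 1 ∧ ‖ζ - z‖ < M * (1 - ‖z‖)}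

/-- `g`, defined on the unit disc, has the nontangential limit `w` at the point `ζ` of the circle. -/
def HasNontangentialLimit (g : ℂ → ℂ) (ζ w : ℂ) : Prop :=
  ∀ M : ℝ, 1 < M → Filter.Tendsto g (nhdsWithin ζ (approachRegion ζ M)) (nhds w)

/-- At almost every point of the unit circle all the components of `F` have nontangential limits,
and the vector `w` of these limits is nonzero and represents a point of `X ⊆ ℂⁿ ⊆ ℙⁿ`. -/
def HasBoundaryValuesIn {n : ℕ} (F : ℂ → Fin (n + 1) → ℂ)
    (X : Set (EuclideanSpace ℂ (Fin n))) : Prop :=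
  ∀ᵐ ζ ∂arcLength, ∃ w : Fin (n + 1) → ℂ,
    (∀ j, HasNontangentialLimit (fun z => F z j) ζ (w j)) ∧
      ∃ h : w ≠ 0, ∃ x ∈ X, Projectivization.mk ℂ w h = affinePoint x

/-! ### Blaschke products and automorphisms of the disc -/

/-- The Blaschke factor with zero `a`. -/
def blaschkeFactor (a z : ℂ) : ℂ :=
  if a = 0 then z else (‖a‖ / a) * ((a - z) / (1 - (starRingEnd ℂ) a * z))

/-- `B` is, on the unit disc, a Blaschke product, finite or infinite: a unimodular constant times
the product of the Blaschke factors of points `a` of the disc with multiplicities `m a`, where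
`∑ m a (1 - |a|) < ∞`. The empty product is allowed. -/
def IsBlaschkeProduct (B : ℂ → ℂ) : Prop :=
  ∃ (c : ℂ) (m : Metric.ball (0 : ℂ) 1 → ℕ), ‖c‖ = 1 ∧
    (Summable fun a => (m a : ℝ) * (1 - ‖(a : ℂ)‖)) ∧
    ∀ z ∈ Metric.ball (0 : ℂ) 1, ∃ p : ℂ,
      HasProd (fun a : Metric.ball (0 : ℂ) 1 => blaschkeFactor a z ^ m a) p ∧ B z = c * p

/-- `α` is, on the unit disc, a holomorphic automorphism of the disc. -/
def IsDiscAut (α : ℂ → ℂ) : Prop :=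
  DifferentiableOn ℂ α (Metric.ball 0 1) ∧
    Set.BijOn α (Metric.ball 0 1) (Metric.ball 0 1)

end DiscFormula

end

/-! Both directions rest on one computation. If a lifting `(B, g)` of `f` has a Blaschke product `B`
as its zeroth component and `B (α 0) ≠ 0`, then `J (f ∘ α) = -log |B (α 0)|`. The multiplicities at
infinity are those of the zeros of `B`, an automorphism transports them, and `|ζ|` is the modulus at
`α 0` of the Blaschke factor of `α ζ` (`J_comp_eq_neg_log`). As `α 0` can be any point of the disc,
(i) says that `V_X (g / B) ≤ -log |B|` off the zeros of `B`.

For (i) ⇒ (ii), `X` lies in a ball of radius `R ≥ 1`, so `log⁺ (‖·‖ / R)` is a competitor for `V_X`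
(`posLog_le_extremalFunction`). The terms `log |B|` cancel in the resulting inequality and leave
`‖g‖ ≤ R`.

For (ii) ⇒ (i), finiteness of `J f` implies the Blaschke condition on the zeros of `f₀`. Dividing
the given lifting by a zero-free function makes its zeroth component a Blaschke product `B`
(`exists_blaschke_lifting`), and `g` is bounded by (ii). For a competitor `u`, logarithmic growth
bounds `u (g / B) + log |B|` above, and its boundary values should be nonpositive since `g / B` has
radial limits in `X`. A maximum principle then gives `u (g / B) ≤ -log |B|`
(`lelongClass_le_neg_log`).

That principle meets two difficulties. The limits lie in `X` only almost everywhere: on circles near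
the boundary the bad set has small measure, so a harmonic polynomial that is small inside dominates
its contribution (`exists_polynomial_majorant`, `re_le_of_nonneg_on_sphere`). Moreover,
plurisubharmonicity is defined by complex lines, not by analytic discs. An auxiliary translation `t`
in `u (h z + t) - N ‖t‖²` absorbs the deviation of the disc `h` from its tangent line
(`Plurisubharmonic.not_eventually_le`). -/

namespace DiscFormula

open MeasureTheory Metric Set Filter Topology Real InnerProductSpace

/-! ### Means over the unit circle -/

theorem arcLength_ae_mem_sphere : ∀ᵐ ζ ∂arcLength, ζ ∈ sphere (0 : ℂ) 1 := by
  refine Measure.ae_smul_measure ?_ _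
  exact (ae_map_iff (p := fun ζ => ζ ∈ sphere (0 : ℂ) 1) (by fun_prop)
    isClosed_sphere.measurableSet).2 (ae_of_all _ fun θ => by simp [circleMap])

instance : IsProbabilityMeasure arcLength := by
  constructor
  rw [arcLength, Measure.smul_apply, Measure.map_apply (by fun_prop) MeasurableSet.univ]
  have h : ENNReal.ofReal (2 * π) ≠ 0 := by simp [Real.pi_pos]
  simp only [preimage_univ, Measure.restrict_apply_univ, Real.volume_Ioc, sub_zero, smul_eq_mul]
  exact ENNReal.inv_mul_cancel h ENNReal.ofReal_ne_top

theorem integrable_arcLength {g : ℂ → ℝ} (hg : ContinuousOn g (sphere 0 1)) :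
    Integrable g arcLength := by
  have h : IntegrableOn g (sphere 0 1) arcLength :=
    hg.integrableOn_compact (isCompact_sphere 0 1)
  rwa [IntegrableOn, Measure.restrict_eq_self_of_ae_mem arcLength_ae_mem_sphere] at h

theorem integral_arcLength {g : ℂ → ℝ} (hg : ContinuousOn g (sphere 0 1)) :
    ∫ ζ, g ζ ∂arcLength = circleAverage g 0 1 := by
  have h := (integrable_arcLength hg).aestronglyMeasurable
  have h2 : ENNReal.ofReal (2 * π) ≠ 0 := by simp [Real.pi_pos]
  have h' : AEStronglyMeasurable g
      ((volume.restrict (Ioc 0 (2 * π))).map (circleMap 0 1)) := by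
    have : (volume.restrict (Ioc 0 (2 * π))).map (circleMap 0 1) ≪ arcLength :=
      Measure.absolutelyContinuous_smul (ENNReal.inv_ne_zero.2 ENNReal.ofReal_ne_top)
    exact h.mono_ac this
  rw [arcLength, integral_smul_measure, integral_map (by fun_prop) h', circleAverage,
    intervalIntegral.integral_of_le (by positivity)]
  rw [ENNReal.toReal_inv, ENNReal.toReal_ofReal (by positivity)]

theorem circleMean_coe {g : ℂ → ℝ} (hg : ContinuousOn g (sphere 0 1)) :
    circleMean (fun ζ => (g ζ : EReal)) = (circleAverage g 0 1 : ℝ) := by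
  have hi := integrable_arcLength hg
  have h1 : (∫⁻ ζ, ENNReal.ofReal (g ζ) ∂arcLength) ≠ ⊤ := hi.lintegral_lt_top.ne
  have h2 : (∫⁻ ζ, ENNReal.ofReal (-g ζ) ∂arcLength) ≠ ⊤ := hi.neg.lintegral_lt_top.ne
  rw [circleMean, ← integral_arcLength hg, integral_eq_lintegral_pos_part_sub_lintegral_neg_part hi,
    EReal.coe_sub, EReal.coe_ennreal_toReal h1, EReal.coe_ennreal_toReal h2]
  rfl

theorem circleMean_mono {g g' : ℂ → EReal} (h : ∀ ζ ∈ sphere (0 : ℂ) 1, g ζ ≤ g' ζ) :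
    circleMean g ≤ circleMean g' := by
  refine EReal.sub_le_sub ?_ ?_
  · refine EReal.coe_ennreal_le_coe_ennreal_iff.2 (lintegral_mono_ae ?_)
    filter_upwards [arcLength_ae_mem_sphere] with ζ hζ
    exact EReal.toENNReal_le_toENNReal (h ζ hζ)
  · refine EReal.coe_ennreal_le_coe_ennreal_iff.2 (lintegral_mono_ae ?_)
    filter_upwards [arcLength_ae_mem_sphere] with ζ hζ
    exact EReal.toENNReal_le_toENNReal (EReal.neg_le_neg_iff.2 (h ζ hζ))

/-! ### A function in the Lelong class -/

/-- Jensen's formula for a linear polynomial: once `q` is factored out, the mean of `log |ζ + c|` is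
`log⁺ |c| ≥ log |c|`. -/
theorem log_norm_le_circleAverage {p q : ℂ} (hp : p ≠ 0) (hq : q ≠ 0) :
    log ‖p‖ ≤ circleAverage (fun ζ => log ‖p + ζ * q‖) 0 1 := by
  have h : circleAverage (fun ζ => log ‖p + ζ * q‖) 0 1 =
      circleAverage (fun ζ => log ‖q‖ + log ‖ζ + p / q‖) 0 1 := by
    apply circleAverage_congr_codiscreteWithin _ (zero_ne_one' ℝ).symm
    have : {z | ‖z + p / q‖ ≠ 0} ∈ codiscreteWithin (Metric.sphere (0 : ℂ) |1|) := by
      apply codiscreteWithin_iff_locallyFiniteComplementWithin.2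
      intro z hz
      refine ⟨Set.univ, univ_mem, Set.Subsingleton.finite ?_⟩
      intro z₁ hz₁ z₂ hz₂
      simp only [ne_eq, univ_inter, Set.mem_sdiff, mem_ofPred_eq, Decidable.not_not,
        norm_eq_zero] at hz₁ hz₂
      rw [add_eq_zero_iff_eq_neg.1 hz₁.2, add_eq_zero_iff_eq_neg.1 hz₂.2]
    filter_upwards [this] with z hz
    rw [← log_mul (norm_ne_zero_iff.2 hq) hz, ← norm_mul]
    congr 2
    field_simp
    ring
  rw [h, ← Pi.add_def, circleAverage_add (circleIntegrable_const (log ‖q‖) 0 1)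
      (MeromorphicOn.circleIntegrable_log_norm (fun _ _ ↦ by fun_prop)), circleAverage_const,
      circleAverage_log_norm_add_const_eq_posLog]
  have : log ‖p / q‖ ≤ posLog ‖p / q‖ := le_max_right _ _
  rw [norm_div, log_div (norm_ne_zero_iff.2 hp) (norm_ne_zero_iff.2 hq)] at this
  rw [norm_div]
  linarith

theorem posLog_norm_le_circleAverage (p q : ℂ) :
    posLog ‖p‖ ≤ circleAverage (fun ζ => posLog ‖p + ζ * q‖) 0 1 := by
  have hc : Continuous fun ζ => posLog ‖p + ζ * q‖ := continuous_posLog.comp (by fun_prop)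
  by_cases hq : q = 0
  · simp [hq, circleAverage_const]
  have h0 := circleAverage_nonneg_of_nonneg (c := 0) (R := 1) (f := fun ζ => posLog ‖p + ζ * q‖)
    fun _ _ => posLog_nonneg
  by_cases hp : p = 0
  · simpa [hp] using h0
  refine max_le h0 ?_
  refine (log_norm_le_circleAverage hp hq).trans ?_
  refine circleAverage_mono (MeromorphicOn.circleIntegrable_log_norm (fun _ _ ↦ by fun_prop))
    hc.continuousOn.circleIntegrable' fun _ _ => le_max_right _ _

variable {n : ℕ}

/-- The linear functional `⟨a, ·⟩ / (R ‖a‖)` is dominated by `‖·‖ / R`, with equality at `a`. This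
reduces the submean inequality at `a` to one variable. -/
theorem posLog_smul_norm_mem_lelongClass {R : ℝ} (hR : 1 ≤ R) :
    (fun z : EuclideanSpace ℂ (Fin n) => ((posLog (R⁻¹ * ‖z‖) : ℝ) : EReal)) ∈ LelongClass n := by
  have hR0 : 0 < R := by linarith
  have hc : Continuous fun z : EuclideanSpace ℂ (Fin n) => posLog (R⁻¹ * ‖z‖) :=
    continuous_posLog.comp (by fun_prop)
  refine ⟨⟨(continuous_coe_real_ereal.comp hc).upperSemicontinuous, fun z => EReal.coe_ne_top _,
    fun a b => ?_⟩, 0, fun z => ?_⟩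
  · have hc' : Continuous fun ζ : ℂ => posLog (R⁻¹ * ‖a + ζ • b‖) := hc.comp (by fun_prop)
    rw [circleMean_coe hc'.continuousOn, EReal.coe_le_coe_iff]
    by_cases ha : a = 0
    · simp only [ha, norm_zero, mul_zero, posLog_zero]
      exact circleAverage_nonneg_of_nonneg fun _ _ => posLog_nonneg
    have ha' : (‖a‖ : ℂ) ≠ 0 := by simpa using ha
    let l : EuclideanSpace ℂ (Fin n) → ℂ := fun z => (R * ‖a‖ : ℂ)⁻¹ * inner ℂ a z
    have hl : ∀ z, ‖l z‖ ≤ R⁻¹ * ‖z‖ := fun z => by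
      have := norm_inner_le_norm (𝕜 := ℂ) a z
      simp only [l, norm_mul, norm_inv, Complex.norm_real, norm_norm, mul_inv, Real.norm_of_nonneg hR0.le]
      have h0 : ‖a‖ ≠ 0 := by simpa using ha
      calc R⁻¹ * ‖a‖⁻¹ * ‖inner ℂ a z‖ ≤ R⁻¹ * ‖a‖⁻¹ * (‖a‖ * ‖z‖) := by gcongr
        _ = R⁻¹ * ‖z‖ := by field_simp
    have hla : ‖l a‖ = R⁻¹ * ‖a‖ := by
      simp only [l, norm_mul, norm_inv, Complex.norm_real, norm_norm, mul_inv, Real.norm_of_nonneg hR0.le, inner_self_eq_norm_sq_to_K]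
      have h0 : ‖a‖ ≠ 0 := by simpa using ha
      simp
      field_simp
    calc posLog (R⁻¹ * ‖a‖) = posLog ‖l a‖ := by rw [hla]
      _ ≤ circleAverage (fun ζ => posLog ‖l a + ζ * l b‖) 0 1 := posLog_norm_le_circleAverage _ _
      _ ≤ _ := by
        refine circleAverage_mono ?_ hc'.continuousOn.circleIntegrable' fun ζ _ => ?_
        · exact (continuous_posLog.comp (by fun_prop)).continuousOn.circleIntegrable'
        · refine posLog_le_posLog (norm_nonneg _) (le_trans (le_of_eq ?_) (hl _))
          simp only [l, inner_add_right, inner_smul_right]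
          congr 1
          ring
  · rw [EReal.coe_le_coe_iff, add_zero]
    refine posLog_le_posLog (by positivity) ?_
    have : R⁻¹ ≤ 1 := inv_le_one_of_one_le₀ hR
    nlinarith [norm_nonneg z]

theorem posLog_le_extremalFunction {X : Set (EuclideanSpace ℂ (Fin n))} {R : ℝ} (hR : 1 ≤ R)
    (hX : ∀ x ∈ X, ‖x‖ ≤ R) (z : EuclideanSpace ℂ (Fin n)) :
    ((posLog (R⁻¹ * ‖z‖) : ℝ) : EReal) ≤ extremalFunction X z := by
  refine le_iSup₂_of_le (fun z => ((posLog (R⁻¹ * ‖z‖) : ℝ) : EReal))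
    ⟨posLog_smul_norm_mem_lelongClass hR, fun x hx => ?_⟩ le_rfl
  have h0 : 0 < R := by linarith
  rw [EReal.coe_nonpos, le_iff_lt_or_eq]
  right
  rw [posLog_eq_zero_iff, abs_of_nonneg (by positivity), inv_mul_le_iff₀ h0, mul_one]
  exact hX x hx

/-! ### Plurisubharmonic functions along analytic discs -/

theorem exists_bound_second_order_remainder {E : Type*} [NormedAddCommGroup E] [NormedSpace ℂ E]
    [CompleteSpace E] {h : ℂ → E} {z₀ : ℂ} (hh : AnalyticAt ℂ h z₀) :
    ∃ K : ℝ, ∀ᶠ z in 𝓝 z₀, ‖h z - h z₀ - (z - z₀) • deriv h z₀‖ ≤ K * ‖z - z₀‖ ^ 2 := by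
  obtain ⟨p, hp⟩ := hh
  have hc : ContinuousAt (dslope (dslope h z₀) z₀) z₀ :=
    hp.has_fpower_series_dslope_fslope.has_fpower_series_dslope_fslope.continuousAt
  refine ⟨‖dslope (dslope h z₀) z₀ z₀‖ + 1, ?_⟩
  filter_upwards [hc.norm.eventually_lt continuousAt_const (lt_add_one _)] with z hz
  have : h z - h z₀ - (z - z₀) • deriv h z₀ =
      (z - z₀) • (z - z₀) • dslope (dslope h z₀) z₀ z := by
    rw [sub_smul_dslope, smul_sub, sub_smul_dslope, dslope_same]
  rw [this, norm_smul, norm_smul, ← mul_assoc, ← pow_two, mul_comm]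
  gcongr

/-- For plurisubharmonic `u`, analytic `h` and harmonic `q`, the function
`(z, t) ↦ u (h z + t) - N ‖t‖² - q z + δ ‖z - z₀‖²` has no local maximum at `(z₀, t₀)`. -/
theorem Plurisubharmonic.not_eventually_le {u : EuclideanSpace ℂ (Fin n) → EReal}
    (hu : Plurisubharmonic u) {h : ℂ → EuclideanSpace ℂ (Fin n)} {z₀ : ℂ}
    {t₀ : EuclideanSpace ℂ (Fin n)} (hh : AnalyticAt ℂ h z₀) {q : ℂ → ℝ} (hq : HarmonicAt q z₀)
    {N δ c₀ : ℝ} (hδ : 0 < δ) (hN : 0 ≤ N) (hc : u (h z₀ + t₀) = c₀) :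
    ¬ ∀ᶠ p in 𝓝 (z₀, t₀), u (h p.1 + p.2) ≤
      ((c₀ + N * (‖p.2‖ ^ 2 - ‖t₀‖ ^ 2) + (q p.1 - q z₀) - δ * ‖p.1 - z₀‖ ^ 2 : ℝ) : EReal) := by
  intro hmax
  set b := deriv h z₀
  let s : ℂ → EuclideanSpace ℂ (Fin n) := fun z => h z - h z₀ - (z - z₀) • b
  obtain ⟨K, hK⟩ := exists_bound_second_order_remainder hh
  have hs : AnalyticAt ℂ s z₀ := by fun_prop
  have hs0 : s z₀ = 0 := by simp [s]
  let Q : ℂ → ℝ := fun z => q z - 2 * N * (inner ℂ t₀ (s z)).re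
  have hQ : HarmonicAt Q z₀ := by
    have h1 : AnalyticAt ℂ (fun z => inner ℂ t₀ (s z)) z₀ :=
      ((innerSL ℂ t₀).analyticAt _).comp hs
    have h2 : HarmonicAt (fun z => (inner ℂ t₀ (s z)).re) z₀ := h1.harmonicAt_re
    exact hq.sub (h2.const_smul (c := 2 * N))
  have hcurve : Tendsto (fun z => (z, t₀ - s z)) (𝓝 z₀) (𝓝 (z₀, t₀)) := by
    have : ContinuousAt (fun z => (z, t₀ - s z)) z₀ :=
      continuousAt_id.prodMk (continuousAt_const.sub hs.continuousAt)
    simpa [ContinuousAt, hs0] using this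
  obtain ⟨ε, hε, hball⟩ := Metric.eventually_nhds_iff.1
    ((hcurve.eventually hmax).and (hK.and hQ.eventually))
  obtain ⟨τ, hτ, hτε, hτN⟩ : ∃ τ : ℝ, 0 < τ ∧ τ < ε ∧ N * K ^ 2 * τ ^ 2 < δ := by
    have h1 : ∀ᶠ τ in 𝓝[>] (0 : ℝ), N * K ^ 2 * τ ^ 2 < δ := by
      have : ContinuousAt (fun τ : ℝ => N * K ^ 2 * τ ^ 2) 0 := by fun_prop
      exact (this.eventually_lt continuousAt_const (by simpa using hδ)).filter_mono
        nhdsWithin_le_nhds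
    obtain ⟨τ, h1, h2⟩ := (h1.and (Ioo_mem_nhdsGT hε)).exists
    exact ⟨τ, h2.1, h2.2, h1⟩
  have hmem : ∀ ζ ∈ closedBall (0 : ℂ) 1, dist (z₀ + τ * ζ) z₀ < ε := fun ζ hζ => by
    rw [dist_self_add_left, norm_mul, Complex.norm_real, Real.norm_eq_abs, abs_of_pos hτ]
    have : ‖ζ‖ ≤ 1 := by simpa using hζ
    nlinarith [norm_nonneg ζ]
  have hQc : ∀ z ∈ closedBall z₀ |τ|, HarmonicAt Q z := fun z hz => by
    refine (hball ?_).2.2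
    rw [abs_of_pos hτ] at hz
    exact lt_of_le_of_lt hz hτε
  let U : ℂ → ℝ := fun ζ => (c₀ - Q z₀ + (N * K ^ 2 * τ ^ 2 - δ) * τ ^ 2) + Q (z₀ + τ * ζ)
  have hQs : ContinuousOn (fun ζ : ℂ => Q (z₀ + τ * ζ)) (sphere 0 1) := by
    intro ζ hζ
    have : ContinuousAt Q (z₀ + τ * ζ) :=
      (hball (hmem ζ (sphere_subset_closedBall hζ))).2.2.1.continuousAt
    exact (this.comp (f := fun ζ : ℂ => z₀ + τ * ζ) (by fun_prop)).continuousWithinAt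
  have hUc : ContinuousOn U (sphere 0 1) := continuousOn_const.add hQs
  have hmean : circleAverage U 0 1 = c₀ + (N * K ^ 2 * τ ^ 2 - δ) * τ ^ 2 := by
    have h1 : circleAverage (fun ζ : ℂ => Q (z₀ + τ * ζ)) 0 1 = Q z₀ := by
      rw [← InnerProductSpace.HarmonicOnNhd.circleAverage_eq hQc,
        circleAverage_eq_circleAverage_zero_one (c := z₀)]
      congr 1
      ext ζ
      congr 1
      ring
    have h2 := circleAverage_fun_add (circleIntegrable_const
      (c₀ - Q z₀ + (N * K ^ 2 * τ ^ 2 - δ) * τ ^ 2) 0 1)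
      (ContinuousOn.circleIntegrable (by norm_num) hQs)
    rw [h1, circleAverage_const] at h2
    simp only [U]
    rw [h2]
    ring
  have hle : (c₀ : EReal) ≤ (circleAverage U 0 1 : ℝ) := by
    rw [← hc, ← circleMean_coe hUc]
    refine (hu.submean _ ((τ : ℂ) • b)).trans (circleMean_mono fun ζ hζ => ?_)
    obtain ⟨h1, h2, -⟩ := hball (hmem ζ (sphere_subset_closedBall hζ))
    set z := z₀ + τ * ζ with hz
    have hzz : z - z₀ = ζ * τ := by rw [hz]; ring
    have hnz : ‖z - z₀‖ = τ := by
      have : ‖ζ‖ = 1 := by simpa using hζ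
      rw [hzz, norm_mul, this, Complex.norm_real, Real.norm_eq_abs, abs_of_pos hτ, one_mul]
    have h3 : h z + (t₀ - s z) = h z₀ + t₀ + ζ • (τ : ℂ) • b := by
      simp only [s, hzz, mul_smul]
      abel
    simp only at h1
    rw [h3] at h1
    refine h1.trans (EReal.coe_le_coe_iff.2 ?_)
    have h4 : ‖t₀ - s z‖ ^ 2 = ‖t₀‖ ^ 2 - 2 * (inner ℂ t₀ (s z)).re + ‖s z‖ ^ 2 := by
      rw [@norm_sub_sq ℂ]; rfl
    have h5 : ‖s z‖ ^ 2 ≤ (K * τ ^ 2) ^ 2 := by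
      rw [hnz] at h2
      exact pow_le_pow_left₀ (norm_nonneg _) h2 2
    have h6 : Q z₀ = q z₀ := by simp [Q, hs0]
    simp only [U, hnz, h4, h6, ← hz]
    simp only [Q]
    nlinarith [mul_le_mul_of_nonneg_left h5 hN]
  rw [EReal.coe_le_coe_iff, hmean] at hle
  nlinarith [mul_pos (sub_pos.2 hτN) (pow_pos hτ 2)]

end DiscFormula

namespace DiscFormula

open MeasureTheory Metric Set Filter Topology Real InnerProductSpace

/-! ### Harmonic majorants -/

/-- Trigonometric polynomials are dense, and on the circle the negative frequencies can be folded
back because `Re ζ⁻ᵏ = Re ζᵏ`. -/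
theorem exists_polynomial_re_near {ψ : ℂ → ℝ} (hψ : Continuous ψ) {ε : ℝ} (hε : 0 < ε) :
    ∃ p : Polynomial ℂ, ∀ ζ ∈ sphere (0 : ℂ) 1, |(p.eval ζ).re - ψ ζ| < ε := by
  have : Fact (0 < 2 * π) := ⟨by positivity⟩
  let x : C(AddCircle (2 * π), ℂ) :=
    ⟨fun t => (ψ (AddCircle.toCircle t : ℂ) : ℂ), by fun_prop⟩
  have hx : x ∈ (Submodule.span ℂ (range (fourier (T := 2 * π)))).topologicalClosure := by
    rw [span_fourier_closure_eq_top]; trivial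
  rw [← SetLike.mem_coe, Submodule.topologicalClosure_coe, Metric.mem_closure_iff] at hx
  obtain ⟨y, hy, hxy⟩ := hx ε hε
  -- Imaginary parts are tracked too, since complex scalars mix them with the real parts.
  have key : ∃ p q : Polynomial ℂ, ∀ t : AddCircle (2 * π),
      (y t).re = (p.eval (AddCircle.toCircle t : ℂ)).re ∧
      (y t).im = (q.eval (AddCircle.toCircle t : ℂ)).re := by
    clear hxy
    induction hy using Submodule.span_induction with
    | mem f hf =>
      obtain ⟨m, rfl⟩ := hf
      rcases Int.eq_nat_or_neg m with ⟨k, rfl | rfl⟩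
      · refine ⟨Polynomial.X ^ k, Polynomial.C (-Complex.I) * Polynomial.X ^ k, fun t => ?_⟩
        simp [fourier_apply, AddCircle.toCircle_nsmul]
      · refine ⟨Polynomial.X ^ k, Polynomial.C Complex.I * Polynomial.X ^ k, fun t => ?_⟩
        rw [fourier_neg, Complex.conj_re, Complex.conj_im]
        simp [fourier_apply, AddCircle.toCircle_nsmul]
    | zero => exact ⟨0, 0, by simp⟩
    | add f g _ _ hf hg =>
      obtain ⟨p, q, h⟩ := hf
      obtain ⟨p', q', h'⟩ := hg
      exact ⟨p + p', q + q', fun t => by simp [h t, h' t]⟩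
    | smul c f _ hf =>
      obtain ⟨p, q, h⟩ := hf
      refine ⟨Polynomial.C (c.re : ℂ) * p - Polynomial.C (c.im : ℂ) * q,
        Polynomial.C (c.re : ℂ) * q + Polynomial.C (c.im : ℂ) * p, fun t => ?_⟩
      simp [h t]
  obtain ⟨p, _, hp⟩ := key
  refine ⟨p, fun ζ hζ => ?_⟩
  obtain ⟨t, ht⟩ := (AddCircle.homeomorphCircle (T := 2 * π) (by positivity)).surjective ⟨ζ, hζ⟩
  rw [AddCircle.homeomorphCircle_apply] at ht
  have ht' : (AddCircle.toCircle t : ℂ) = ζ := by rw [ht]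
  have h1 := (ContinuousMap.dist_apply_le_dist t).trans_lt hxy
  rw [dist_comm, dist_eq_norm] at h1
  have h2 := (Complex.abs_re_le_norm _).trans_lt h1
  simpa [x, (hp t).1, ht'] using h2

/-- Harnack's inequality: the Poisson kernel at `w` is at most `(1 + ‖w‖) / (1 - ‖w‖)`. -/
theorem re_le_of_nonneg_on_sphere {p : Polynomial ℂ}
    (hp : ∀ ζ ∈ sphere (0 : ℂ) 1, 0 ≤ (p.eval ζ).re) {w : ℂ} {κ : ℝ} (hw : ‖w‖ ≤ κ)
    (hκ : κ < 1) : (p.eval w).re ≤ 2 / (1 - κ) * (p.eval 0).re := by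
  have hharm : HarmonicOnNhd (fun z => (p.eval z).re) (closedBall 0 1) := fun z _ =>
    ((Differentiable.analyticAt p.differentiable z)).harmonicAt_re
  have hw1 : w ∈ ball (0 : ℂ) 1 := by simpa using hw.trans_lt hκ
  have h1 := InnerProductSpace.HarmonicOnNhd.circleAverage_re_herglotzRieszKernel_smul hharm hw1
  have h0 := InnerProductSpace.HarmonicOnNhd.circleAverage_eq (f := fun z => (p.eval z).re)
    (c := 0) (R := 1) (by simpa using hharm)
  have hc : ContinuousOn (fun z : ℂ => (p.eval z).re) (sphere 0 |1|) := by fun_prop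
  have hk : ContinuousOn ((Complex.re ∘ herglotzRieszKernel 0 w) • fun z : ℂ => (p.eval z).re)
      (sphere 0 |1|) :=
    (Complex.continuous_re.comp_continuousOn (continuousOn_herglotzRieszKernel_sphere hw1)).smul hc
  rw [← h1, ← h0, ← smul_eq_mul, ← circleAverage_smul]
  refine circleAverage_mono hk.circleIntegrable' (hc.const_smul _).circleIntegrable' fun z hz => ?_
  rw [abs_one] at hz
  simp only [Pi.smul_apply', smul_eq_mul, Function.comp]
  refine mul_le_mul_of_nonneg_right ?_ (hp z hz)
  refine (re_herglotzRieszKernel_le hz hw1).trans ?_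
  rw [sub_zero]
  have := norm_nonneg w
  exact div_le_div₀ (by norm_num) (by linarith) (by linarith) (by linarith)

theorem exists_polynomial_majorant {A : Set ℂ} (hA : IsClosed A) {M η : ℝ} (hM : 0 ≤ M)
    (hη : 0 < η) :
    ∃ p : Polynomial ℂ, (∀ ζ ∈ sphere (0 : ℂ) 1, 0 ≤ (p.eval ζ).re) ∧
      (∀ ζ ∈ sphere (0 : ℂ) 1, ζ ∈ A → M ≤ (p.eval ζ).re) ∧
      (p.eval 0).re ≤ M * arcLength.real A + η := by
  have hδ : ∀ k : ℕ, 0 < 1 / ((k : ℝ) + 1) := fun k => by positivity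
  have hlim := (tendsto_integral_thickenedIndicator_of_isClosed arcLength hA hδ
    tendsto_one_div_add_atTop_nhds_zero_nat).const_mul M
  obtain ⟨k, hk⟩ := (hlim.eventually_lt_const
    (show M * arcLength.real A < M * arcLength.real A + η / 3 by linarith)).exists
  set χ : ℂ → ℝ := fun ζ => thickenedIndicator (hδ k) A ζ
  have hχ : Continuous χ := by fun_prop
  -- The thirds of `η`: a shift that offsets the approximation error, that error itself, and the
  -- excess of the mean of `M * χ` over `M` times the measure of `A`.
  obtain ⟨p, hp⟩ := exists_polynomial_re_near (ψ := fun ζ => M * χ ζ + η / 3) (by fun_prop)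
    (show 0 < η / 3 by linarith)
  refine ⟨p, fun ζ hζ => ?_, fun ζ hζ hζA => ?_, ?_⟩
  · have := (abs_lt.1 (hp ζ hζ)).1
    have h1 : 0 ≤ M * χ ζ := mul_nonneg hM (NNReal.coe_nonneg _)
    linarith
  · have := (abs_lt.1 (hp ζ hζ)).1
    have h1 : χ ζ = 1 := by
      simp only [χ]
      rw [thickenedIndicator_one (hδ k) A hζA]
      rfl
    rw [h1] at this
    linarith
  · have h0 := InnerProductSpace.HarmonicOnNhd.circleAverage_eq (f := fun z => (p.eval z).re)
      (c := 0) (R := 1) fun z _ =>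
        ((Differentiable.analyticAt p.differentiable z)).harmonicAt_re
    have hc : Continuous (fun z : ℂ => (p.eval z).re) := by fun_prop
    rw [← h0, ← integral_arcLength hc.continuousOn]
    have hχi : Integrable χ arcLength := integrable_arcLength hχ.continuousOn
    calc ∫ ζ, (p.eval ζ).re ∂arcLength ≤ ∫ ζ, (M * χ ζ + 2 * (η / 3)) ∂arcLength := by
          refine integral_mono_ae (integrable_arcLength hc.continuousOn)
            ((hχi.const_mul M).add (integrable_const _)) ?_
          filter_upwards [arcLength_ae_mem_sphere] with ζ hζ
          have := (abs_lt.1 (hp ζ hζ)).2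
          linarith
      _ = M * ∫ ζ, χ ζ ∂arcLength + 2 * (η / 3) := by
          rw [integral_add (hχi.const_mul M) (integrable_const _), integral_const_mul]
          simp
      _ ≤ _ := by linarith

/-! ### The maximum principle -/

theorem add_coe_le_coe_iff {x : EReal} {c y : ℝ} : x + c ≤ y ↔ x ≤ ((y - c : ℝ) : EReal) := by
  induction x with
  | bot => simp
  | top => simp [-EReal.coe_sub]
  | coe x =>
    rw [← EReal.coe_add, EReal.coe_le_coe_iff, EReal.coe_le_coe_iff]
    constructor <;> intro <;> linarith

theorem upperSemicontinuousOn_add_coe {α : Type*} [TopologicalSpace α] {s : Set α} {f : α → EReal}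
    {c : α → ℝ} (hf : UpperSemicontinuousOn f s) (hc : ContinuousOn c s) :
    UpperSemicontinuousOn (fun x => f x + (c x : EReal)) s := fun x hx =>
  UpperSemicontinuousWithinAt.add' (hf x hx) ((continuous_coe_real_ereal.continuousAt.comp_continuousWithinAt
    (hc x hx)).upperSemicontinuousWithinAt) (EReal.continuousAt_add (by simp) (by simp))

variable {n : ℕ}

/-- If the bound failed at `a` by `v > 0`, a penalised function of `(z, t)` would have a maximum
over a compact set, necessarily an interior one, against `Plurisubharmonic.not_eventually_le`. The
hypotheses involve `u (h z + t)` because `t` must be free to move. -/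
theorem Plurisubharmonic.le_of_le_on_sphere {u : EuclideanSpace ℂ (Fin n) → EReal}
    (hu : Plurisubharmonic u) {B : ℂ → ℂ} {h : ℂ → EuclideanSpace ℂ (Fin n)} {p : Polynomial ℂ}
    (hB : DifferentiableOn ℂ B (ball 0 1)) (hB1 : ∀ z ∈ ball (0 : ℂ) 1, ‖B z‖ ≤ 1)
    (hh : ∀ z ∈ ball (0 : ℂ) 1, B z ≠ 0 → AnalyticAt ℂ h z) {M r ρ : ℝ} (hr : r < 1)
    (hρ : 0 < ρ)
    (hM : ∀ z ∈ ball (0 : ℂ) 1, B z ≠ 0 → ∀ t, ‖t‖ ≤ ρ →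
      u (h z + t) ≤ ((M - log ‖B z‖ : ℝ) : EReal))
    (hp : ∀ z ∈ sphere (0 : ℂ) r, 0 ≤ (p.eval z).re)
    (hpM : ∀ z ∈ sphere (0 : ℂ) r, B z ≠ 0 → (∃ t, ‖t‖ ≤ ρ ∧ 0 < u (h z + t)) →
      M ≤ (p.eval z).re)
    {a : ℂ} (ha : ‖a‖ ≤ r) (hBa : B a ≠ 0) :
    u (h a) ≤ (((p.eval a).re - log ‖B a‖ : ℝ) : EReal) := by
  by_contra! hlt
  have hsub : closedBall (0 : ℂ) r ⊆ ball 0 1 := closedBall_subset_ball hr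
  obtain ⟨ca, hca⟩ : ∃ c : ℝ, u (h a) = c :=
    ⟨(u (h a)).toReal, (EReal.coe_toReal (hu.ne_top _) (ne_bot_of_gt hlt)).symm⟩
  have ha1 : a ∈ closedBall (0 : ℂ) r := by simpa using ha
  have hlogB : ∀ z ∈ ball (0 : ℂ) 1, log ‖B z‖ ≤ 0 := fun z hz =>
    log_nonpos (norm_nonneg _) (hB1 z hz)
  obtain ⟨v, hv, hv0⟩ : ∃ v, v = ca + log ‖B a‖ - (p.eval a).re ∧ 0 < v := by
    refine ⟨_, rfl, ?_⟩
    rw [hca, EReal.coe_lt_coe_iff] at hlt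
    linarith
  obtain ⟨ε, hε, hεv⟩ : ∃ ε : ℝ, 0 < ε ∧ ε * -log ‖B a‖ ≤ v / 4 := by
    have h1 : 0 ≤ -log ‖B a‖ := by linarith [hlogB a (hsub ha1)]
    refine ⟨v / 4 / (-log ‖B a‖ + 1), by positivity, ?_⟩
    rw [div_mul_eq_mul_div, div_le_iff₀ (by positivity)]
    nlinarith
  have hpc : Continuous fun z => (p.eval z).re := by fun_prop
  obtain ⟨L, hL⟩ : ∃ L, ∀ z ∈ closedBall (0 : ℂ) r, ‖(p.eval z).re‖ ≤ L :=
    (isCompact_closedBall 0 r).exists_bound_of_continuousOn hpc.continuousOn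
  obtain ⟨N, hN0, hN⟩ : ∃ N : ℝ, 0 ≤ N ∧ M + L + v / 4 - N * ρ ^ 2 ≤ 0 := by
    refine ⟨|M + L + v / 4| / ρ ^ 2, by positivity, ?_⟩
    rw [div_mul_cancel₀ _ (by positivity)]
    linarith [le_abs_self (M + L + v / 4)]
  obtain ⟨β, hβ0, hβa, hβ⟩ : ∃ β : ℝ, 0 < β ∧ β ≤ ‖B a‖ ∧ M + L + v / 4 + ε * log β ≤ 0 := by
    have h1 : Tendsto (fun β => M + L + v / 4 + ε * log β) (𝓝[>] 0) atBot :=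
      tendsto_atBot_add_const_left _ _ (tendsto_log_nhdsGT_zero.const_mul_atBot hε)
    obtain ⟨β, h2, h3⟩ := ((h1.eventually_le_atBot 0).and
      (Ioc_mem_nhdsGT (norm_pos_iff.2 hBa))).exists
    exact ⟨β, h3.1, h3.2, h2⟩
  let S : Set ℂ := closedBall 0 r ∩ {z | β ≤ ‖B z‖}
  have hBc : ContinuousOn B (closedBall 0 r) := hB.continuousOn.mono hsub
  have hS : IsCompact S := (isCompact_closedBall 0 r).of_isClosed_subset
    (hBc.norm.preimage_isClosed_of_isClosed isClosed_closedBall isClosed_Ici) inter_subset_left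
  let K : Set (ℂ × EuclideanSpace ℂ (Fin n)) := S ×ˢ closedBall 0 ρ
  have hK : IsCompact K := hS.prod (isCompact_closedBall 0 ρ)
  have hSB : ∀ z ∈ S, B z ≠ 0 := fun z hz h0 => by
    have := hz.2
    simp only [mem_ofPred_eq, h0, norm_zero] at this
    linarith
  -- The term in `N` keeps the maximum off `‖t‖ = ρ`, the surplus `ε log ‖B‖` keeps it off `‖B‖ =
  -- β`, and `v / 4 * ‖z‖²` makes subharmonicity strict. At `(a, 0)` the penalised value is still at
  -- least `3 * v / 4`.
  let c : ℂ × EuclideanSpace ℂ (Fin n) → ℝ := fun x =>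
    -N * ‖x.2‖ ^ 2 + (1 + ε) * log ‖B x.1‖ - (p.eval x.1).re + v / 4 * ‖x.1‖ ^ 2
  have hBK : ContinuousOn (fun x : ℂ × EuclideanSpace ℂ (Fin n) => log ‖B x.1‖) K := by
    refine ContinuousOn.log ?_ fun x hx => norm_ne_zero_iff.2 (hSB _ hx.1)
    exact (hBc.comp continuousOn_fst fun x hx => hx.1.1).norm
  have hc : ContinuousOn c K := by
    have h1 : Continuous fun x : ℂ × EuclideanSpace ℂ (Fin n) => -N * ‖x.2‖ ^ 2 := by fun_prop
    have h2 : Continuous fun x : ℂ × EuclideanSpace ℂ (Fin n) => (p.eval x.1).re := by fun_prop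
    have h3 : Continuous fun x : ℂ × EuclideanSpace ℂ (Fin n) => v / 4 * ‖x.1‖ ^ 2 := by fun_prop
    exact ((h1.continuousOn.add (continuousOn_const.mul hBK)).sub h2.continuousOn).add
      h3.continuousOn
  have hucs : UpperSemicontinuousOn (fun x : ℂ × EuclideanSpace ℂ (Fin n) => u (h x.1 + x.2)) K := by
    have h1 : ContinuousOn (fun x : ℂ × EuclideanSpace ℂ (Fin n) => h x.1 + x.2) K := by
      intro x hx
      have := (hh x.1 (hsub hx.1.1) (hSB _ hx.1)).continuousAt
      exact ((this.comp (f := Prod.fst) continuousAt_fst).add continuousAt_snd).continuousWithinAt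
    exact (hu.upperSemicontinuous.upperSemicontinuousOn univ).comp h1 (mapsTo_univ _ _)
  have haK : (a, 0) ∈ K := ⟨⟨ha1, hβa⟩, by simp [hρ.le]⟩
  obtain ⟨⟨z₀, t₀⟩, hz₀, hmax⟩ := (upperSemicontinuousOn_add_coe hucs hc).exists_isMaxOn
    ⟨_, haK⟩ hK
  have hmax' : ∀ x ∈ K, u (h x.1 + x.2) + (c x : EReal) ≤ u (h z₀ + t₀) + (c (z₀, t₀) : EReal) :=
    fun x hx => hmax hx
  have hlow : ((3 * v / 4 : ℝ) : EReal) ≤ u (h z₀ + t₀) + (c (z₀, t₀) : EReal) := by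
    refine le_trans ?_ (hmax' _ haK)
    simp only [add_zero, hca, ← EReal.coe_add, EReal.coe_le_coe_iff, c, norm_zero]
    nlinarith [norm_nonneg a]
  obtain ⟨c₀, hc₀⟩ : ∃ c : ℝ, u (h z₀ + t₀) = c := by
    refine ⟨(u (h z₀ + t₀)).toReal, (EReal.coe_toReal (hu.ne_top _) fun h0 => ?_).symm⟩
    rw [h0, EReal.bot_add] at hlow
    exact absurd hlow (by simp)
  simp only [hc₀, ← EReal.coe_add] at hmax' hlow
  rw [EReal.coe_le_coe_iff] at hlow
  have hz₀r : z₀ ∈ closedBall (0 : ℂ) r := hz₀.1.1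
  have hz₀1 := hsub hz₀r
  have hBz₀ : B z₀ ≠ 0 := hSB _ hz₀.1
  have ht₀ : ‖t₀‖ ≤ ρ := by simpa using hz₀.2
  have hup : c₀ ≤ M - log ‖B z₀‖ := by
    have := hM z₀ hz₀1 hBz₀ t₀ ht₀
    rwa [hc₀, EReal.coe_le_coe_iff] at this
  have hHL : -L ≤ (p.eval z₀).re := (abs_le.1 (hL z₀ hz₀r)).1
  have hlog0 := hlogB z₀ hz₀1
  have hz₀n : v / 4 * ‖z₀‖ ^ 2 ≤ v / 4 := by
    have h1 : ‖z₀‖ < 1 := by simpa using hz₀1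
    have : ‖z₀‖ ^ 2 ≤ 1 := pow_le_one₀ (norm_nonneg _) h1.le
    nlinarith
  have hNt : 0 ≤ N * ‖t₀‖ ^ 2 := by positivity
  have hεlog : ε * log ‖B z₀‖ ≤ 0 := mul_nonpos_of_nonneg_of_nonpos hε.le hlog0
  simp only [c] at hlow
  have ht₀' : ‖t₀‖ < ρ := by
    refine lt_of_le_of_ne ht₀ fun h0 => ?_
    rw [h0] at hlow
    nlinarith
  have hβ' : β < ‖B z₀‖ := by
    refine lt_of_le_of_ne hz₀.1.2 fun h0 => ?_
    rw [← h0] at hlow hup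
    nlinarith
  -- On the circle, either `c₀ ≤ 0`, or `M ≤ Re p` cancels the bound `M` for `c₀ + log ‖B z₀‖`. In
  -- both cases at most `v / 4` remains.
  have hz₀' : ‖z₀‖ < r := by
    refine lt_of_le_of_ne (by simpa using hz₀r) fun h0 => ?_
    have hs : z₀ ∈ sphere (0 : ℂ) r := by simpa using h0
    have h1 := hp z₀ hs
    by_cases h2 : c₀ ≤ 0
    · nlinarith
    · have := hpM z₀ hs hBz₀ ⟨t₀, ht₀, by rw [hc₀]; exact_mod_cast not_le.1 h2⟩
      nlinarith
  have hBan : AnalyticAt ℂ B z₀ := hB.analyticAt (isOpen_ball.mem_nhds hz₀1)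
  -- In `‖z‖² = ‖z - z₀‖² + 2 Re (conj z₀ * z) - ‖z₀‖²` the middle term is harmonic, whence the
  -- coefficient `v / 2` here and `δ = v / 4`.
  let q : ℂ → ℝ := fun z =>
    (p.eval z).re - (1 + ε) * log ‖B z‖ - v / 2 * (starRingEnd ℂ z₀ * z).re
  have hq : HarmonicAt q z₀ := by
    have h1 : HarmonicAt (fun z => (p.eval z).re) z₀ :=
      ((Differentiable.analyticAt p.differentiable z₀)).harmonicAt_re
    have h2 : HarmonicAt (fun z => log ‖B z‖) z₀ := hBan.harmonicAt_log_norm hBz₀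
    have h3 : AnalyticAt ℂ (fun z => starRingEnd ℂ z₀ * z) z₀ := by fun_prop
    exact (h1.sub (h2.const_smul (c := 1 + ε))).sub (h3.harmonicAt_re.const_smul (c := v / 2))
  refine hu.not_eventually_le (hh z₀ hz₀1 hBz₀) hq (δ := v / 4) (by linarith) hN0 hc₀ ?_
  have e1 : ∀ᶠ x : ℂ × EuclideanSpace ℂ (Fin n) in 𝓝 (z₀, t₀), ‖x.1‖ < r :=
    (continuous_fst.norm.continuousAt).eventually_lt continuousAt_const hz₀'
  have e2 : ∀ᶠ x : ℂ × EuclideanSpace ℂ (Fin n) in 𝓝 (z₀, t₀), ‖x.2‖ < ρ :=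
    (continuous_snd.norm.continuousAt).eventually_lt continuousAt_const ht₀'
  have e3 : ∀ᶠ x : ℂ × EuclideanSpace ℂ (Fin n) in 𝓝 (z₀, t₀), β < ‖B x.1‖ :=
    continuousAt_const.eventually_lt
      (hBan.continuousAt.comp (f := Prod.fst) continuousAt_fst).norm hβ'
  filter_upwards [e1, e2, e3] with x h1 h2 h3
  have := add_coe_le_coe_iff.1 (hmax' x ⟨⟨by simpa using h1.le, h3.le⟩, by simpa using h2.le⟩)
  refine this.trans (EReal.coe_le_coe_iff.2 (le_of_eq ?_))
  have h4 : ‖x.1 - z₀‖ ^ 2 = ‖x.1‖ ^ 2 + ‖z₀‖ ^ 2 - 2 * (starRingEnd ℂ z₀ * x.1).re := by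
    rw [← Complex.normSq_eq_norm_sq, ← Complex.normSq_eq_norm_sq, ← Complex.normSq_eq_norm_sq,
      Complex.normSq_sub]
    rw [mul_comm x.1]
  have h5 : (starRingEnd ℂ z₀ * z₀).re = ‖z₀‖ ^ 2 := by
    rw [← Complex.normSq_eq_conj_mul_self, Complex.ofReal_re, Complex.normSq_eq_norm_sq]
  simp only [c, q, h4, h5]
  ring

theorem mem_of_notMem_cthickening_compl {E : Type*} [SeminormedAddCommGroup E] {X : Set E} {ρ : ℝ}
    {x t : E} (hx : x ∉ cthickening ρ Xᶜ) (ht : ‖t‖ ≤ ρ) : x + t ∈ X := by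
  by_contra h
  exact hx (mem_cthickening_of_dist_le x (x + t) ρ _ h (by simpa using ht))

theorem eventually_notMem_cthickening_compl {E : Type*} [SeminormedAddCommGroup E] {X : Set E}
    (hX : IsOpen X) {x : E} (hx : x ∈ X) {y : ℕ → E} {ρ : ℕ → ℝ}
    (hy : Tendsto y atTop (𝓝 x)) (hρ : Tendsto ρ atTop (𝓝 0)) :
    ∀ᶠ k in atTop, y k ∉ cthickening (ρ k) Xᶜ := by
  obtain ⟨ε, hε, hεX⟩ := Metric.isOpen_iff.1 hX x hx
  filter_upwards [hρ.eventually_lt_const (show 0 < ε / 2 by positivity),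
    hy.eventually (ball_mem_nhds x (show 0 < ε / 2 by positivity))] with k h1 h2 h3
  obtain ⟨w, hw, hwk⟩ := mem_thickening_iff.1
    (cthickening_subset_thickening' (by positivity) h1 Xᶜ h3)
  refine hw (hεX ?_)
  rw [mem_ball]
  linarith [dist_triangle w (y k) x, dist_comm w (y k)]

/-- If the radial limits of the disc `g / B` lie in `X` almost everywhere, `|B| ≤ 1` and `g` is
bounded, then functions in the Lelong class that are nonpositive on `X` are at most `-log |B|` on
the disc. -/
theorem lelongClass_le_neg_log {u : EuclideanSpace ℂ (Fin n) → EReal} (hu : u ∈ LelongClass n)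
    {X : Set (EuclideanSpace ℂ (Fin n))} (hX : IsOpen X) (huX : ∀ x ∈ X, u x ≤ 0) {B : ℂ → ℂ}
    {g : ℂ → EuclideanSpace ℂ (Fin n)} (hB : DifferentiableOn ℂ B (ball 0 1))
    (hB1 : ∀ z ∈ ball (0 : ℂ) 1, ‖B z‖ ≤ 1) (hg : DifferentiableOn ℂ g (ball 0 1)) {G : ℝ}
    (hG : ∀ z ∈ ball (0 : ℂ) 1, ‖g z‖ ≤ G)
    (hlim : ∀ᵐ ζ ∂arcLength, ∃ x ∈ X, (∀ᶠ r : ℝ in 𝓝[<] 1, B (r * ζ) ≠ 0) ∧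
      Tendsto (fun r : ℝ => (B (r * ζ))⁻¹ • g (r * ζ)) (𝓝[<] 1) (𝓝 x))
    {a : ℂ} (ha : a ∈ ball (0 : ℂ) 1) (hBa : B a ≠ 0) :
    u ((B a)⁻¹ • g a) ≤ ((-log ‖B a‖ : ℝ) : EReal) := by
  obtain ⟨hpsh, C, hC⟩ := hu
  set h : ℂ → EuclideanSpace ℂ (Fin n) := fun z => (B z)⁻¹ • g z with hdef
  have hG0 : 0 ≤ G := (norm_nonneg _).trans (hG a ha)
  -- Since `‖B‖ ≤ 1`, `‖h z + t‖` and `1` are both at most `(G + 1) / ‖B z‖` for `‖t‖ ≤ 1`.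
  set M := log (G + 1) + |C| with hMdef
  have hM0 : 0 ≤ M := add_nonneg (log_nonneg (by linarith)) (abs_nonneg _)
  have hM : ∀ z ∈ ball (0 : ℂ) 1, B z ≠ 0 → ∀ t, ‖t‖ ≤ 1 →
      u (h z + t) ≤ ((M - log ‖B z‖ : ℝ) : EReal) := fun z hz hBz t ht => by
    refine (hC _).trans (EReal.coe_le_coe_iff.2 ?_)
    have hb : 0 < ‖B z‖ := norm_pos_iff.2 hBz
    have h1 : posLog ‖h z + t‖ ≤ log ((G + 1) / ‖B z‖) := by
      rw [posLog_eq_log_max_one (norm_nonneg _)]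
      refine log_le_log (by positivity) (max_le ?_ ?_)
      · rw [one_le_div hb]
        linarith [hB1 z hz]
      · refine (norm_add_le _ _).trans ?_
        rw [le_div_iff₀ hb, add_mul]
        simp only [hdef, norm_smul, norm_inv]
        rw [inv_mul_eq_div, div_mul_cancel₀ _ hb.ne']
        nlinarith [hG z hz, hB1 z hz, norm_nonneg t]
    rw [log_div (by positivity) hb.ne'] at h1
    linarith [le_abs_self C]
  have hh : ∀ z ∈ ball (0 : ℂ) 1, B z ≠ 0 → AnalyticAt ℂ h z := fun z hz hBz =>
    ((hB.analyticAt (isOpen_ball.mem_nhds hz)).inv hBz).smul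
      (hg.analyticAt (isOpen_ball.mem_nhds hz))
  let ρ : ℕ → ℝ := fun k => 1 / ((k : ℝ) + 1)
  have hρ0 : ∀ k, 0 < ρ k := fun k => by positivity
  have hρ1 : ∀ k, ρ k ≤ 1 := fun k => by
    refine div_le_one_of_le₀ ?_ (by positivity)
    linarith [(k.cast_nonneg : (0 : ℝ) ≤ k)]
  have hρ : Tendsto ρ atTop (𝓝 0) := tendsto_one_div_add_atTop_nhds_zero_nat
  let r : ℕ → ℝ := fun k => 1 - ρ k
  have hr1 : ∀ k, r k < 1 := fun k => by linarith [hρ0 k]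
  have hr0 : ∀ k, 0 ≤ r k := fun k => by linarith [hρ1 k]
  have hr : Tendsto r atTop (𝓝[<] 1) := by
    refine tendsto_nhdsWithin_iff.2 ⟨by simpa using hρ.const_sub 1, Eventually.of_forall hr1⟩
  have hrζ : ∀ k, ∀ ζ ∈ sphere (0 : ℂ) 1, r k * ζ ∈ ball (0 : ℂ) 1 := fun k ζ hζ => by
    have : ‖ζ‖ = 1 := by simpa using hζ
    simpa [this, abs_of_nonneg (hr0 k)] using hr1 k
  -- The bad directions at radius `r k`. Off `A k`, every translate of `h` by `t` with `‖t‖ ≤ ρ k`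
  -- stays in `X`, where `u ≤ 0`. Almost every `ζ` eventually leaves `A k`, so the measures tend to
  -- `0`.
  let A : ℕ → Set ℂ := fun k =>
    sphere 0 1 ∩ {ζ | B (r k * ζ) ≠ 0 ∧ h (r k * ζ) ∉ cthickening (ρ k) Xᶜ}ᶜ
  have hA : ∀ k, IsClosed (A k) := fun k => by
    rw [← isOpen_compl_iff, isOpen_iff_mem_nhds]
    intro ζ hζ
    by_cases hs : ζ ∈ sphere (0 : ℂ) 1
    · obtain ⟨h1, h2⟩ : B (r k * ζ) ≠ 0 ∧ h (r k * ζ) ∉ cthickening (ρ k) Xᶜ := by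
        by_contra h0
        exact hζ ⟨hs, h0⟩
      have hm : ContinuousAt (fun ζ : ℂ => r k * ζ) ζ := by fun_prop
      have c1 : ContinuousAt (fun ζ => B (r k * ζ)) ζ :=
        (hB.continuousOn.continuousAt (isOpen_ball.mem_nhds (hrζ k ζ hs))).comp
          (f := fun ζ : ℂ => r k * ζ) hm
      have c2 : ContinuousAt (fun ζ => h (r k * ζ)) ζ :=
        (hh _ (hrζ k ζ hs) h1).continuousAt.comp (f := fun ζ : ℂ => r k * ζ) hm
      filter_upwards [c1.eventually_ne h1,
        c2.eventually (isClosed_cthickening.isOpen_compl.mem_nhds h2)] with w hw1 hw2 hw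
      exact hw.2 ⟨hw1, hw2⟩
    · exact mem_of_superset (isClosed_sphere.isOpen_compl.mem_nhds hs) fun w hw hw' => hw hw'.1
  have hAlim : Tendsto (fun k => arcLength.real (A k)) atTop (𝓝 0) := by
    have := tendsto_measure_of_ae_tendsto_indicator_of_isFiniteMeasure (μ := arcLength) atTop
      MeasurableSet.empty (fun k => (hA k).measurableSet) (by
        filter_upwards [hlim] with ζ ⟨x, hx, h1, h2⟩
        filter_upwards [hr.eventually h1,
          eventually_notMem_cthickening_compl hX hx (h2.comp hr) hρ] with k h3 h4
        exact ⟨fun h5 => h5.2 ⟨h3, h4⟩, fun h5 => h5.elim⟩)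
    rw [measure_empty] at this
    exact (ENNReal.tendsto_toReal ENNReal.zero_ne_top).comp this
  have ha' : ‖a‖ < 1 := by simpa using ha
  -- A bound for `‖a‖ / r k` once `r k > (1 + ‖a‖) / 2`.
  set κ := 2 * ‖a‖ / (1 + ‖a‖) with hκdef
  have hκ : κ < 1 := by
    rw [hκdef, div_lt_one (by positivity)]
    linarith
  have hbound : ∀ᶠ k in atTop, u (h a) ≤
      ((2 / (1 - κ) * (M * arcLength.real (A k) + ρ k) - log ‖B a‖ : ℝ) : EReal) := by
    have h1 : ∀ᶠ k in atTop, (1 + ‖a‖) / 2 < r k :=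
      (hr.mono_right nhdsWithin_le_nhds).eventually_const_lt (by linarith)
    filter_upwards [h1] with k hk
    have hrk : 0 < r k := by linarith [norm_nonneg a]
    obtain ⟨p, hp0, hpA, hp⟩ := exists_polynomial_majorant (hA k) hM0 (hρ0 k)
    have hmem : ∀ z ∈ sphere (0 : ℂ) (r k), (r k : ℂ)⁻¹ * z ∈ sphere (0 : ℂ) 1 := fun z hz => by
      have : ‖z‖ = r k := by simpa using hz
      simp [this, abs_of_pos hrk, hrk.ne']
    have heval : ∀ z, (p.comp (Polynomial.C (r k : ℂ)⁻¹ * Polynomial.X)).eval z =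
        p.eval ((r k : ℂ)⁻¹ * z) := fun z => by simp
    have hrc : (r k : ℂ) ≠ 0 := by exact_mod_cast hrk.ne'
    have := hpsh.le_of_le_on_sphere (p := p.comp (Polynomial.C (r k : ℂ)⁻¹ * Polynomial.X))
      hB hB1 hh (hr1 k) (hρ0 k)
      (fun z hz hBz t ht => hM z hz hBz t (ht.trans (hρ1 k)))
      (fun z hz => by rw [heval]; exact hp0 _ (hmem z hz))
      (fun z hz hBz ⟨t, ht, hut⟩ => by
        rw [heval]
        refine hpA _ (hmem z hz) ⟨hmem z hz, fun hgood => ?_⟩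
        simp only [mem_ofPred_eq, mul_inv_cancel_left₀ hrc] at hgood
        exact absurd (huX _ (mem_of_notMem_cthickening_compl hgood.2 ht)) (not_le.2 hut))
      (a := a) (by linarith) hBa
    refine this.trans (EReal.coe_le_coe_iff.2 (sub_le_sub_right ?_ _))
    rw [heval]
    refine (re_le_of_nonneg_on_sphere hp0 (κ := κ) ?_ hκ).trans ?_
    · rw [norm_mul, norm_inv, Complex.norm_real, norm_of_nonneg hrk.le, hκdef, inv_mul_eq_div,
        div_le_div_iff₀ hrk (by positivity)]
      nlinarith [norm_nonneg a]
    · exact mul_le_mul_of_nonneg_left hp (div_nonneg (by norm_num) (by linarith))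
  have hlim' : Tendsto (fun k => 2 / (1 - κ) * (M * arcLength.real (A k) + ρ k) - log ‖B a‖)
      atTop (𝓝 (-log ‖B a‖)) := by
    simpa using (((hAlim.const_mul M).add hρ).const_mul (2 / (1 - κ))).sub_const (log ‖B a‖)
  exact ge_of_tendsto ((continuous_coe_real_ereal.tendsto _).comp hlim') hbound

end DiscFormula

namespace DiscFormula

open MeasureTheory Metric Set Filter Topology Real

/-! ### Blaschke factors -/

theorem one_sub_conj_mul_ne_zero {a z : ℂ} (ha : ‖a‖ < 1) (hz : ‖z‖ < 1) :
    1 - starRingEnd ℂ a * z ≠ 0 := by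
  intro h
  have h1 : ‖starRingEnd ℂ a * z‖ = 1 := by rw [← sub_eq_zero.1 h, norm_one]
  rw [norm_mul, RCLike.norm_conj] at h1
  nlinarith [norm_nonneg a, norm_nonneg z]

theorem norm_blaschkeFactor (a z : ℂ) :
    ‖blaschkeFactor a z‖ = ‖a - z‖ / ‖1 - starRingEnd ℂ a * z‖ := by
  rw [blaschkeFactor]
  split_ifs with h
  · simp [h]
  · rw [norm_mul, norm_div, norm_div, Complex.norm_real, norm_norm,
      div_self (norm_ne_zero_iff.2 h), one_mul]

theorem norm_blaschkeFactor_comm (a z : ℂ) : ‖blaschkeFactor a z‖ = ‖blaschkeFactor z a‖ := by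
  rw [norm_blaschkeFactor, norm_blaschkeFactor, norm_sub_rev,
    ← RCLike.norm_conj (1 - starRingEnd ℂ a * z)]
  simp [mul_comm]

theorem normSq_one_sub_conj_mul_sub (a z : ℂ) :
    Complex.normSq (1 - starRingEnd ℂ a * z) - Complex.normSq (a - z) =
      (1 - Complex.normSq a) * (1 - Complex.normSq z) := by
  simp only [Complex.normSq_apply, Complex.sub_re, Complex.sub_im, Complex.mul_re, Complex.mul_im,
    Complex.conj_re, Complex.conj_im, Complex.one_re, Complex.one_im]
  ring

theorem norm_blaschkeFactor_lt_one {a z : ℂ} (ha : ‖a‖ < 1) (hz : ‖z‖ < 1) :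
    ‖blaschkeFactor a z‖ < 1 := by
  rw [norm_blaschkeFactor, div_lt_one (norm_pos_iff.2 (one_sub_conj_mul_ne_zero ha hz))]
  refine lt_of_pow_lt_pow_left₀ 2 (norm_nonneg _) ?_
  have h := normSq_one_sub_conj_mul_sub a z
  simp only [Complex.normSq_eq_norm_sq] at h
  have h1 : 0 < 1 - ‖a‖ ^ 2 := by nlinarith [norm_nonneg a]
  have h2 : 0 < 1 - ‖z‖ ^ 2 := by nlinarith [norm_nonneg z]
  nlinarith [mul_pos h1 h2]

theorem blaschkeFactor_eq_zero_iff {a z : ℂ} (ha : ‖a‖ < 1) (hz : ‖z‖ < 1) :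
    blaschkeFactor a z = 0 ↔ z = a := by
  rw [← norm_eq_zero, norm_blaschkeFactor, div_eq_zero_iff, norm_eq_zero, norm_eq_zero,
    or_iff_left (one_sub_conj_mul_ne_zero ha hz), sub_eq_zero, eq_comm]

theorem differentiableOn_blaschkeFactor {a : ℂ} (ha : ‖a‖ < 1) :
    DifferentiableOn ℂ (blaschkeFactor a) (ball 0 1) := by
  unfold blaschkeFactor
  split_ifs with h
  · fun_prop
  · intro z hz
    have := one_sub_conj_mul_ne_zero ha (by simpa using hz : ‖z‖ < 1)
    refine DifferentiableAt.differentiableWithinAt ?_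
    fun_prop (disch := assumption)

/-- For `a ≠ 0` the difference is `(1 - |a|) (a + |a| z) / (a (1 - conj a * z))`. The factor `1 -
|a|` is what turns the Blaschke condition into locally uniform convergence. -/
theorem norm_one_sub_blaschkeFactor_le {a z : ℂ} (ha : ‖a‖ < 1) (hz : ‖z‖ < 1) :
    ‖1 - blaschkeFactor a z‖ ≤ 2 / (1 - ‖z‖) * (1 - ‖a‖) := by
  have hz' : 0 < 1 - ‖z‖ := by linarith
  have ha' : 0 < 1 - ‖a‖ := by linarith
  by_cases h : a = 0
  · simp only [blaschkeFactor, h, if_true, norm_zero, sub_zero, mul_one]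
    rw [le_div_iff₀ hz']
    have := norm_sub_le 1 z
    rw [norm_one] at this
    nlinarith [norm_nonneg z]
  · have h1 := one_sub_conj_mul_ne_zero ha hz
    have h2 : 1 - blaschkeFactor a z =
        (1 - ‖a‖) * ((a + ‖a‖ * z) / (a * (1 - starRingEnd ℂ a * z))) := by
      rw [blaschkeFactor, if_neg h]
      have h3 : starRingEnd ℂ a * a = (‖a‖ : ℂ) ^ 2 := by rw [Complex.conj_mul']
      rw [div_mul_div_comm, mul_div_assoc', eq_div_iff (mul_ne_zero h h1), sub_mul,
        div_mul_cancel₀ _ (mul_ne_zero h h1)]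
      linear_combination (-z) * h3
    have h4 : ‖(a + ‖a‖ * z) / (a * (1 - starRingEnd ℂ a * z))‖ ≤ 2 / (1 - ‖z‖) := by
      have h5 : 1 - ‖z‖ ≤ ‖1 - starRingEnd ℂ a * z‖ := by
        have := norm_sub_norm_le 1 (starRingEnd ℂ a * z)
        rw [norm_one, norm_mul, RCLike.norm_conj] at this
        nlinarith [norm_nonneg a, norm_nonneg z]
      have h6 : ‖a + ‖a‖ * z‖ ≤ ‖a‖ * 2 := by
        refine (norm_add_le _ _).trans ?_
        rw [norm_mul, Complex.norm_real, norm_norm]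
        nlinarith [norm_nonneg a]
      have h7 : 0 < ‖a‖ := norm_pos_iff.2 h
      rw [norm_div, norm_mul]
      calc ‖a + ‖a‖ * z‖ / (‖a‖ * ‖1 - starRingEnd ℂ a * z‖)
          ≤ (‖a‖ * 2) / (‖a‖ * (1 - ‖z‖)) := by gcongr
        _ = 2 / (1 - ‖z‖) := by field_simp
    rw [h2, norm_mul, mul_comm]
    refine mul_le_mul h4 (le_of_eq ?_) (norm_nonneg _) (by positivity)
    rw [← Complex.ofReal_one, ← Complex.ofReal_sub, Complex.norm_real, norm_of_nonneg ha'.le]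

theorem norm_pow_sub_one_le {x : ℂ} (hx : ‖x‖ ≤ 1) (k : ℕ) : ‖x ^ k - 1‖ ≤ k * ‖1 - x‖ := by
  induction k with
  | zero => simp
  | succ k ih =>
    have : x ^ (k + 1) - 1 = (x ^ k - 1) * x + (x - 1) := by ring
    rw [this]
    refine (norm_add_le _ _).trans ?_
    rw [norm_mul, norm_sub_rev x 1]
    push_cast
    nlinarith [norm_nonneg (x ^ k - 1), norm_nonneg x]

theorem analyticOrderAt_blaschkeFactor {a : ℂ} (ha : ‖a‖ < 1) :
    analyticOrderAt (blaschkeFactor a) a = 1 := by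
  have han : AnalyticAt ℂ (blaschkeFactor a) a :=
    (differentiableOn_blaschkeFactor ha).analyticAt (isOpen_ball.mem_nhds (by simpa using ha))
  rw [show (1 : ℕ∞) = (1 : ℕ) from rfl, han.analyticOrderAt_eq_natCast]
  have h1 := one_sub_conj_mul_ne_zero ha ha
  by_cases h : a = 0
  · exact ⟨fun _ => 1, by fun_prop, by simp, Eventually.of_forall fun z => by
      simp [blaschkeFactor, h]⟩
  · refine ⟨fun z => -(‖a‖ / a) / (1 - starRingEnd ℂ a * z), by fun_prop (disch := assumption),
      div_ne_zero (by simp [h]) h1, Eventually.of_forall fun z => ?_⟩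
    simp only [blaschkeFactor, h, if_false, pow_one, smul_eq_mul]
    ring

/-! ### Blaschke products -/

/-- The product of the Blaschke factors of the points `a` of the disc with multiplicities `m a`. -/
noncomputable def blaschkeProduct (m : ball (0 : ℂ) 1 → ℕ) (z : ℂ) : ℂ :=
  ∏' a : ball (0 : ℂ) 1, blaschkeFactor a z ^ m a

variable {m : ball (0 : ℂ) 1 → ℕ}

theorem norm_blaschkeFactor_pow_sub_one_le {r : ℝ} (hr : r < 1) {z : ℂ}
    (hz : ‖z‖ ≤ r) (a : ball (0 : ℂ) 1) (k : ℕ) :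
    ‖blaschkeFactor a z ^ k - 1‖ ≤ 2 / (1 - r) * (k * (1 - ‖(a : ℂ)‖)) := by
  have ha : ‖(a : ℂ)‖ < 1 := mem_ball_zero_iff.1 a.2
  refine (norm_pow_sub_one_le (norm_blaschkeFactor_lt_one ha (hz.trans_lt hr)).le k).trans ?_
  have h1 := norm_one_sub_blaschkeFactor_le ha (hz.trans_lt hr)
  have h2 : 2 / (1 - ‖z‖) ≤ 2 / (1 - r) := by
    have : 0 < 1 - r := by linarith
    gcongr
  have h3 : 0 < 1 - ‖(a : ℂ)‖ := by linarith
  calc (k : ℝ) * ‖1 - blaschkeFactor a z‖ ≤ k * (2 / (1 - r) * (1 - ‖(a : ℂ)‖)) := by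
        gcongr
        exact h1.trans (by gcongr)
    _ = _ := by ring

theorem summable_norm_blaschkeFactor_pow_sub_one
    (hm : Summable fun a => (m a : ℝ) * (1 - ‖(a : ℂ)‖)) {z : ℂ} (hz : z ∈ ball (0 : ℂ) 1) :
    Summable fun a : ball (0 : ℂ) 1 => ‖blaschkeFactor a z ^ m a - 1‖ := by
  have hz' : ‖z‖ < 1 := by simpa using hz
  exact (hm.mul_left (2 / (1 - ‖z‖))).of_nonneg_of_le (fun _ => norm_nonneg _)
    fun a => norm_blaschkeFactor_pow_sub_one_le hz' le_rfl a (m a)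

theorem hasProd_blaschkeProduct
    (hm : Summable fun a => (m a : ℝ) * (1 - ‖(a : ℂ)‖)) {z : ℂ} (hz : z ∈ ball (0 : ℂ) 1) :
    HasProd (fun a : ball (0 : ℂ) 1 => blaschkeFactor a z ^ m a) (blaschkeProduct m z) := by
  have := multipliable_one_add_of_summable (summable_norm_blaschkeFactor_pow_sub_one hm hz)
  simp only [add_sub_cancel] at this
  exact this.hasProd

theorem differentiableOn_blaschkeProduct
    (hm : Summable fun a => (m a : ℝ) * (1 - ‖(a : ℂ)‖)) :
    DifferentiableOn ℂ (blaschkeProduct m) (ball 0 1) := by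
  intro z hz
  have hz' : ‖z‖ < 1 := by simpa using hz
  obtain ⟨r, hzr, hr⟩ := exists_between hz'
  have hsub : ball (0 : ℂ) r ⊆ ball 0 1 := ball_subset_ball hr.le
  have hd : ∀ a : ball (0 : ℂ) 1,
      DifferentiableOn ℂ (fun z => blaschkeFactor a z ^ m a - 1) (ball 0 r) := fun a =>
    (((differentiableOn_blaschkeFactor (mem_ball_zero_iff.1 a.2)).mono hsub).pow _).sub_const _
  have h := (hm.mul_left (2 / (1 - r))).hasProdLocallyUniformlyOn_one_add (K := ball (0 : ℂ) r)
    (f := fun (a : ball (0 : ℂ) 1) z => blaschkeFactor a z ^ m a - 1) isOpen_ball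
    (Eventually.of_forall fun a z hz =>
      norm_blaschkeFactor_pow_sub_one_le hr (by simpa using (mem_ball_zero_iff.1 hz).le) a (m a))
    fun a => (hd a).continuousOn
  simp only [add_sub_cancel] at h
  rw [hasProdLocallyUniformlyOn_iff_tendstoLocallyUniformlyOn] at h
  have h2 := h.differentiableOn (Eventually.of_forall fun s => by
    refine DifferentiableOn.fun_finsetProd fun a _ => ?_
    exact ((differentiableOn_blaschkeFactor (mem_ball_zero_iff.1 a.2)).mono hsub).pow _) isOpen_ball
  exact (h2.differentiableAt (isOpen_ball.mem_nhds (by simpa using hzr))).differentiableWithinAt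

theorem norm_blaschkeProduct_le_one
    (hm : Summable fun a => (m a : ℝ) * (1 - ‖(a : ℂ)‖)) {z : ℂ} (hz : z ∈ ball (0 : ℂ) 1) :
    ‖blaschkeProduct m z‖ ≤ 1 := by
  refine le_of_tendsto (hasProd_blaschkeProduct hm hz).norm (Eventually.of_forall fun s => ?_)
  refine Finset.prod_le_one (fun _ _ => norm_nonneg _) fun a _ => ?_
  rw [norm_pow]
  exact pow_le_one₀ (norm_nonneg _)
    (norm_blaschkeFactor_lt_one (mem_ball_zero_iff.1 a.2) (by simpa using hz)).le

theorem blaschkeProduct_ne_zero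
    (hm : Summable fun a => (m a : ℝ) * (1 - ‖(a : ℂ)‖)) {z : ℂ} (hz : z ∈ ball (0 : ℂ) 1) (h0 : m ⟨z, hz⟩ = 0) :
    blaschkeProduct m z ≠ 0 := by
  have := tprod_one_add_ne_zero_of_summable
    (f := fun a : ball (0 : ℂ) 1 => blaschkeFactor a z ^ m a - 1) (fun a => ?_)
    (summable_norm_blaschkeFactor_pow_sub_one hm hz)
  · simp only [add_sub_cancel] at this
    exact this
  · rw [add_sub_cancel]
    by_cases h : z = a
    · have : a = ⟨z, hz⟩ := Subtype.ext h.symm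
      rw [this, h0, pow_zero]
      exact one_ne_zero
    · exact pow_ne_zero _ fun h' => h ((blaschkeFactor_eq_zero_iff (mem_ball_zero_iff.1 a.2)
        (by simpa using hz)).1 h')

theorem summable_update_zero
    (hm : Summable fun a => (m a : ℝ) * (1 - ‖(a : ℂ)‖)) [DecidableEq (ball (0 : ℂ) 1)] (w : ball (0 : ℂ) 1) :
    Summable fun a => (Function.update m w 0 a : ℝ) * (1 - ‖(a : ℂ)‖) := by
  refine hm.of_nonneg_of_le (fun a => ?_) fun a => ?_ <;>
  have h1 : 0 ≤ 1 - ‖(a : ℂ)‖ := by linarith [mem_ball_zero_iff.1 a.2]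
  · positivity
  · by_cases h : a = w
    · simp only [h, Function.update_self, Nat.cast_zero, zero_mul]
      subst h
      positivity
    · simp [h]

theorem blaschkeProduct_eq_mul
    (hm : Summable fun a => (m a : ℝ) * (1 - ‖(a : ℂ)‖)) [DecidableEq (ball (0 : ℂ) 1)] (w : ball (0 : ℂ) 1) {z : ℂ}
    (hz : z ∈ ball (0 : ℂ) 1) : blaschkeProduct m z =
      blaschkeFactor w z ^ m w * blaschkeProduct (Function.update m w 0) z := by
  have h1 : HasProd (fun a : ball (0 : ℂ) 1 => if a = w then blaschkeFactor w z ^ m w else 1)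
      (blaschkeFactor w z ^ m w) := hasProd_ite_eq w _
  have h2 := h1.mul (hasProd_blaschkeProduct (summable_update_zero hm w) hz)
  refine (hasProd_blaschkeProduct hm hz).unique (h2.congr_fun fun a => ?_)
  by_cases h : a = w
  · simp [h]
  · simp [h]

/-- Splitting off the factor of `w` leaves a convergent product that does not vanish at `w`. -/
theorem analyticOrderAt_blaschkeProduct
    (hm : Summable fun a => (m a : ℝ) * (1 - ‖(a : ℂ)‖)) (w : ball (0 : ℂ) 1) :
    analyticOrderAt (blaschkeProduct m) w = m w := by
  classical
  have hw : ‖(w : ℂ)‖ < 1 := mem_ball_zero_iff.1 w.2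
  have hn : ball (0 : ℂ) 1 ∈ 𝓝 (w : ℂ) := isOpen_ball.mem_nhds w.2
  have hm' := summable_update_zero hm w
  have h1 : blaschkeProduct m =ᶠ[𝓝 (w : ℂ)]
      (blaschkeFactor w ^ m w) * blaschkeProduct (Function.update m w 0) := by
    filter_upwards [hn] with z hz using blaschkeProduct_eq_mul hm w hz
  have h2 : AnalyticAt ℂ (blaschkeFactor w) w :=
    (differentiableOn_blaschkeFactor hw).analyticAt hn
  have h3 : AnalyticAt ℂ (blaschkeProduct (Function.update m w 0)) w :=
    (differentiableOn_blaschkeProduct hm').analyticAt hn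
  have h4 : blaschkeProduct (Function.update m w 0) (w : ℂ) ≠ 0 :=
    blaschkeProduct_ne_zero hm' w.2 (by simp)
  rw [analyticOrderAt_congr h1, analyticOrderAt_mul (h2.pow _) h3, analyticOrderAt_pow h2,
    analyticOrderAt_blaschkeFactor hw, h3.analyticOrderAt_eq_zero.2 h4]
  simp

theorem hasSum_neg_log_blaschkeProduct
    (hm : Summable fun a => (m a : ℝ) * (1 - ‖(a : ℂ)‖)) {z : ℂ} (hz : z ∈ ball (0 : ℂ) 1)
    (h0 : blaschkeProduct m z ≠ 0) :
    HasSum (fun a : ball (0 : ℂ) 1 => (m a : ℝ) * -log ‖blaschkeFactor a z‖)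
      (-log ‖blaschkeProduct m z‖) := by
  classical
  have h1 : ∀ a : ball (0 : ℂ) 1, ‖blaschkeFactor a z ^ m a‖ ≠ 0 := fun a h => by
    rw [norm_eq_zero] at h
    exact h0 (by rw [blaschkeProduct_eq_mul hm a hz, h, zero_mul])
  have h2 := ((continuousAt_log (norm_ne_zero_iff.2 h0)).tendsto.comp
    (hasProd_blaschkeProduct hm hz).norm).neg
  refine h2.congr fun s => ?_
  simp only [Function.comp]
  rw [log_prod fun a _ => h1 a, ← Finset.sum_neg_distrib]
  refine Finset.sum_congr rfl fun a _ => ?_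
  rw [norm_pow, log_pow]
  ring

end DiscFormula

namespace DiscFormula

open MeasureTheory Metric Set Filter Topology

/-! ### Automorphisms of the disc -/

/-- The involution of the disc that interchanges `0` and `a`. -/
noncomputable def discInvolution (a z : ℂ) : ℂ := (a - z) / (1 - starRingEnd ℂ a * z)

theorem norm_discInvolution (a z : ℂ) : ‖discInvolution a z‖ = ‖blaschkeFactor a z‖ := by
  rw [norm_blaschkeFactor, discInvolution, norm_div]

theorem discInvolution_mem_ball {a z : ℂ} (ha : ‖a‖ < 1) (hz : z ∈ ball (0 : ℂ) 1) :
    discInvolution a z ∈ ball (0 : ℂ) 1 := by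
  rw [mem_ball_zero_iff, norm_discInvolution]
  exact norm_blaschkeFactor_lt_one ha (mem_ball_zero_iff.1 hz)

theorem discInvolution_discInvolution {a z : ℂ} (ha : ‖a‖ < 1) (hz : z ∈ ball (0 : ℂ) 1) :
    discInvolution a (discInvolution a z) = z := by
  have h1 := one_sub_conj_mul_ne_zero ha (mem_ball_zero_iff.1 hz)
  have h2 := one_sub_conj_mul_ne_zero ha ha
  have h3 : a - discInvolution a z =
      z * (1 - starRingEnd ℂ a * a) / (1 - starRingEnd ℂ a * z) := by
    rw [discInvolution, eq_div_iff h1, sub_mul, div_mul_cancel₀ _ h1]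
    ring
  have h4 : 1 - starRingEnd ℂ a * discInvolution a z =
      (1 - starRingEnd ℂ a * a) / (1 - starRingEnd ℂ a * z) := by
    rw [discInvolution, eq_div_iff h1, sub_mul, mul_assoc, div_mul_cancel₀ _ h1]
    ring
  rw [discInvolution, h3, h4, div_div_div_cancel_right₀ h1, mul_div_cancel_right₀ _ h2]

theorem differentiableOn_discInvolution {a : ℂ} (ha : ‖a‖ < 1) :
    DifferentiableOn ℂ (discInvolution a) (ball 0 1) := by
  intro z hz
  have := one_sub_conj_mul_ne_zero ha (mem_ball_zero_iff.1 hz)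
  refine DifferentiableAt.differentiableWithinAt ?_
  unfold discInvolution
  fun_prop (disch := assumption)

theorem isDiscAut_discInvolution {a : ℂ} (ha : ‖a‖ < 1) : IsDiscAut (discInvolution a) :=
  ⟨differentiableOn_discInvolution ha, InvOn.bijOn
    ⟨fun _ hz => discInvolution_discInvolution ha hz, fun _ hz => discInvolution_discInvolution ha hz⟩
    (fun _ hz => discInvolution_mem_ball ha hz) fun _ hz => discInvolution_mem_ball ha hz⟩

/-- The open mapping theorem makes the inverse continuous, and it is differentiable where `α' ≠ 0`.
Zeros of `α'` are isolated, as `α` is injective, so their images are removable singularities. -/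
theorem exists_differentiableOn_inverse {U V : Set ℂ} {α : ℂ → ℂ} (hU : IsOpen U)
    (hUc : IsPreconnected U) (hd : DifferentiableOn ℂ α U) (hα : BijOn α U V) :
    ∃ β : ℂ → ℂ, DifferentiableOn ℂ β V ∧ MapsTo β V U ∧ InvOn β α U V := by
  have han : AnalyticOnNhd ℂ α U := hd.analyticOnNhd hU
  let β := Function.invFunOn α U
  have hinv : InvOn β α U V := hα.invOn_invFunOn
  have hβ : MapsTo β V U := hα.surjOn.mapsTo_invFunOn
  have hopen : ∀ s ⊆ U, IsOpen s → IsOpen (α '' s) := by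
    rcases han.is_constant_or_isOpen hUc with ⟨w, hw⟩ | h
    · intro s hs hso
      have : s = ∅ := by
        by_contra hne
        obtain ⟨z, hz⟩ := nonempty_iff_ne_empty.2 hne
        have h1 : s ⊆ {z} := fun y hy => hα.injOn (hs hy) (hs hz) (by rw [hw _ (hs hy), hw _ (hs hz)])
        have h2 : s = {z} := Subset.antisymm h1 (by simpa using hz)
        exact not_isOpen_singleton z (h2 ▸ hso)
      simp [this]
    · exact h
  have hV : IsOpen V := by rw [← hα.image_eq]; exact hopen U Subset.rfl hU
  have hβc : ∀ w ∈ V, ContinuousAt β w := fun w hw s hs => by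
    obtain ⟨t, hts, hto, hwt⟩ := _root_.mem_nhds_iff.1 (inter_mem hs (hU.mem_nhds (hβ hw)))
    rw [mem_map]
    refine mem_of_superset ((hopen t (fun y hy => (hts hy).2) hto).mem_nhds
      ⟨β w, hwt, hinv.2 hw⟩) ?_
    rintro _ ⟨y, hy, rfl⟩
    rw [mem_preimage, hinv.1 (hts hy).2]
    exact (hts hy).1
  have hβd : ∀ w ∈ V, deriv α (β w) ≠ 0 → DifferentiableAt ℂ β w := fun w hw h0 =>
    (HasDerivAt.of_local_left_inverse (hβc w hw)
      ((hd.differentiableAt (hU.mem_nhds (hβ hw))).hasDerivAt) h0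
      (by filter_upwards [hV.mem_nhds hw] with y hy using hinv.2 hy)).differentiableAt
  refine ⟨β, fun w hw => DifferentiableAt.differentiableWithinAt ?_, hβ, hinv⟩
  have hbw := hβ hw
  rcases (han.deriv _ hbw).eventually_eq_zero_or_eventually_ne_zero with h | h
  · exfalso
    obtain ⟨ε, hε, hεs⟩ := Metric.mem_nhds_iff.1 (inter_mem h (hU.mem_nhds hbw))
    have hconst : ∀ y ∈ ball (β w) ε, α y = α (β w) := fun y hy =>
      (convex_ball (β w) ε).is_const_of_fderivWithin_eq_zero (𝕜 := ℂ)
        (hd.mono fun y hy => (hεs hy).2) (fun y hy => by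
          rw [fderivWithin_of_isOpen isOpen_ball hy]
          have h1 : deriv α y = 0 := (hεs hy).1
          ext
          simp [h1]) hy (mem_ball_self hε)
    have h1 : ball (β w) ε ⊆ {β w} := fun y hy =>
      hα.injOn (hεs hy).2 hbw (hconst y hy)
    have h2 : ball (β w) ε = {β w} := Subset.antisymm h1 (by simpa using hε)
    exact not_isOpen_singleton (β w) (h2 ▸ isOpen_ball)
  · refine (Complex.analyticAt_of_differentiable_on_punctured_nhds_of_continuousAt ?_
      (hβc w hw)).differentiableAt
    have ht : Tendsto β (𝓝[≠] w) (𝓝[≠] (β w)) := by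
      refine tendsto_nhdsWithin_iff.2 ⟨(hβc w hw).tendsto.mono_left nhdsWithin_le_nhds, ?_⟩
      filter_upwards [self_mem_nhdsWithin, nhdsWithin_le_nhds (hV.mem_nhds hw)] with y hy hyV h0
      exact hy (by rw [mem_singleton_iff, ← hinv.2 hyV, ← hinv.2 hw]; exact congrArg α h0)
    filter_upwards [ht.eventually h, nhdsWithin_le_nhds (hV.mem_nhds hw)] with y hy hyV
    exact hβd y hyV hy

theorem IsDiscAut.deriv_ne_zero {α : ℂ → ℂ} (hα : IsDiscAut α) {z : ℂ} (hz : z ∈ ball (0 : ℂ) 1) :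
    deriv α z ≠ 0 := by
  obtain ⟨β, hβ, -, hinv⟩ := exists_differentiableOn_inverse isOpen_ball
    (convex_ball 0 1).isPreconnected hα.1 hα.2
  have h1 := (hα.1.differentiableAt (isOpen_ball.mem_nhds hz)).hasDerivAt
  have h2 := (hβ.differentiableAt (isOpen_ball.mem_nhds (hα.2.mapsTo hz))).hasDerivAt
  have h3 : HasDerivAt (β ∘ α) 1 z := by
    refine (hasDerivAt_id z).congr_of_eventuallyEq ?_
    filter_upwards [isOpen_ball.mem_nhds hz] with y hy using hinv.1 hy
  intro h0
  have := (h2.comp z h1).unique h3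
  rw [h0, mul_zero] at this
  exact zero_ne_one this

/-- The Schwarz lemma, applied to `α` followed by the involution of `α 0` and to the inverse of this
map; both fix `0`. -/
theorem IsDiscAut.norm_blaschkeFactor {α : ℂ → ℂ} (hα : IsDiscAut α) {z : ℂ}
    (hz : z ∈ ball (0 : ℂ) 1) : ‖blaschkeFactor (α 0) (α z)‖ = ‖z‖ := by
  obtain ⟨β, hβ, hβm, hinv⟩ := exists_differentiableOn_inverse isOpen_ball
    (convex_ball 0 1).isPreconnected hα.1 hα.2
  have h0 : (0 : ℂ) ∈ ball (0 : ℂ) 1 := by simp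
  have ha : ‖α 0‖ < 1 := mem_ball_zero_iff.1 (hα.2.mapsTo h0)
  have hd := differentiableOn_discInvolution ha
  have hm : MapsTo (discInvolution (α 0)) (ball 0 1) (ball 0 1) :=
    fun _ h => discInvolution_mem_ball ha h
  have haz := hα.2.mapsTo hz
  rw [← norm_discInvolution]
  refine le_antisymm ?_ ?_
  · exact Complex.norm_le_norm_of_mapsTo_ball (f := discInvolution (α 0) ∘ α) (R := 1)
      (hd.comp hα.1 hα.2.mapsTo) ((hm.comp hα.2.mapsTo).mono_right ball_subset_closedBall)
      (by simp [discInvolution]) (mem_ball_zero_iff.1 hz)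
  · have := Complex.norm_le_norm_of_mapsTo_ball (f := β ∘ discInvolution (α 0)) (R := 1)
      (z := discInvolution (α 0) (α z))
      (hβ.comp hd hm) ((hβm.comp hm).mono_right ball_subset_closedBall)
      (by simp [discInvolution, hinv.1 h0]) (mem_ball_zero_iff.1 (hm haz))
    rwa [Function.comp_apply, discInvolution_discInvolution ha haz, hinv.1 hz] at this

/-! ### Liftings and multiplicities -/

theorem mk_eq_mk_mul_eq {ι : Type*} {v w : ι → ℂ} {hv : v ≠ 0} {hw : w ≠ 0}
    (h : Projectivization.mk ℂ v hv = Projectivization.mk ℂ w hw) (i j : ι) :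
    v i * w j = w i * v j := by
  obtain ⟨a, rfl⟩ := (Projectivization.mk_eq_mk_iff' ℂ v w hv hw).1 h
  simp only [Pi.smul_apply, smul_eq_mul]
  ring

variable {n : ℕ} {f : ℂ → ℙ ℂ (Fin (n + 1) → ℂ)}

/-- Two liftings differ near `ζ` by the zero-free holomorphic factor `F j / F' j`, where `F ζ j ≠
0`. -/
theorem IsLiftingOn.analyticOrderAt_eq {U U' : Set ℂ} {F F' : ℂ → Fin (n + 1) → ℂ} {ζ : ℂ}
    (hF : IsLiftingOn U F f) (hF' : IsLiftingOn U' F' f) (hU : U ∈ 𝓝 ζ) (hU' : U' ∈ 𝓝 ζ) :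
    analyticOrderAt (fun z => F z 0) ζ = analyticOrderAt (fun z => F' z 0) ζ := by
  have key : ∀ z ∈ U ∩ U', ∀ i j, F z i * F' z j = F' z i * F z j := fun z hz => by
    obtain ⟨h1, h2⟩ := hF.2 z hz.1
    obtain ⟨h3, h4⟩ := hF'.2 z hz.2
    exact mk_eq_mk_mul_eq (h2.symm.trans h4)
  have hζ := mem_of_mem_nhds (inter_mem hU hU')
  have an : ∀ j, AnalyticAt ℂ (fun z => F z j) ζ := fun j =>
    (differentiableOn_pi.1 hF.1 j).analyticAt hU
  have an' : ∀ j, AnalyticAt ℂ (fun z => F' z j) ζ := fun j =>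
    (differentiableOn_pi.1 hF'.1 j).analyticAt hU'
  obtain ⟨j, hj⟩ := Function.ne_iff.1 (hF.2 ζ hζ.1).1
  have hj : F ζ j ≠ 0 := hj
  have hj' : F' ζ j ≠ 0 := fun h0 => (hF'.2 ζ hζ.2).1 (funext fun i => by
    have := key ζ hζ i j
    rw [h0, mul_zero, eq_comm, mul_eq_zero, or_iff_left hj] at this
    exact this)
  have hq : AnalyticAt ℂ (fun z => F z j / F' z j) ζ := (an j).div (an' j) hj'
  have heq : (fun z => F z 0) =ᶠ[𝓝 ζ] (fun z => F z j / F' z j) * fun z => F' z 0 := by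
    filter_upwards [inter_mem hU hU', (an' j).continuousAt.eventually_ne hj'] with z hz hz0
    have := key z hz 0 j
    simp only [Pi.mul_apply]
    field_simp
    linear_combination this
  rw [analyticOrderAt_congr heq, analyticOrderAt_mul hq (an' 0),
    hq.analyticOrderAt_eq_zero.2 (div_ne_zero hj hj'), zero_add]

theorem IsLiftingOn.multAtInfinity_eq {U : Set ℂ} {F : ℂ → Fin (n + 1) → ℂ} {ζ : ℂ}
    (hF : IsLiftingOn U F f) (hU : IsOpen U) (hζ : ζ ∈ U) :
    multAtInfinity f ζ = analyticOrderAt (fun z => F z 0) ζ := by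
  refine le_antisymm (iSup_le fun U' => iSup_le fun F' => iSup_le fun h => ?_)
    (le_iSup_of_le U (le_iSup_of_le F (le_iSup_of_le ⟨hU, hζ, hF⟩ le_rfl)))
  exact (h.2.2.analyticOrderAt_eq hF (h.1.mem_nhds h.2.1) (hU.mem_nhds hζ)).le

theorem IsLiftingOn.comp {U V : Set ℂ} {F : ℂ → Fin (n + 1) → ℂ} {α : ℂ → ℂ}
    (hF : IsLiftingOn V F f) (hα : DifferentiableOn ℂ α U) (hm : MapsTo α U V) :
    IsLiftingOn U (F ∘ α) (f ∘ α) :=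
  ⟨hF.1.comp hα hm, fun z hz => hF.2 (α z) (hm hz)⟩

/-! ### The disc functional -/

theorem toENNReal_neg_log_enorm {z : ℂ} (hz : z ≠ 0) :
    (-ENNReal.log ‖z‖ₑ).toENNReal = ENNReal.ofReal (-Real.log ‖z‖) := by
  rw [← ofReal_norm, ENNReal.log_ofReal_of_pos (norm_pos_iff.2 hz), ← EReal.coe_neg,
    EReal.real_coe_toENNReal]

/-- The comparison by which `J f < ⊤` yields the Blaschke condition. -/
theorem ofReal_one_sub_norm_le (z : ℂ) :
    ENNReal.ofReal (1 - ‖z‖) ≤ (-ENNReal.log ‖z‖ₑ).toENNReal := by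
  by_cases hz : z = 0
  · simp [hz]
  · rw [toENNReal_neg_log_enorm hz]
    refine ENNReal.ofReal_le_ofReal ?_
    linarith [Real.log_le_sub_one_of_pos (norm_pos_iff.2 hz)]

/-- For a lifting whose zeroth component is a Blaschke product `B`, the disc functional of `f ∘ α`
is `-log |B (α 0)|`. -/
theorem J_comp_eq_neg_log {G : ℂ → Fin (n + 1) → ℂ} (hG : IsLiftingOn (ball 0 1) G f)
    {c : ℂ} (hc : ‖c‖ = 1) {m : ball (0 : ℂ) 1 → ℕ}
    (hm : Summable fun a => (m a : ℝ) * (1 - ‖(a : ℂ)‖))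
    (hB : ∀ z ∈ ball (0 : ℂ) 1, G z 0 = c * blaschkeProduct m z) {α : ℂ → ℂ} (hα : IsDiscAut α)
    (h0 : G (α 0) 0 ≠ 0) :
    (J (f ∘ α) : EReal) = ((-Real.log ‖G (α 0) 0‖ : ℝ) : EReal) := by
  classical
  have hc0 : c ≠ 0 := norm_ne_zero_iff.1 (by rw [hc]; exact one_ne_zero)
  have ha : α 0 ∈ ball (0 : ℂ) 1 := hα.2.mapsTo (by simp)
  have hB0 : blaschkeProduct m (α 0) ≠ 0 := fun h => h0 (by rw [hB _ ha, h, mul_zero])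
  have hnorm : ‖G (α 0) 0‖ = ‖blaschkeProduct m (α 0)‖ := by
    rw [hB _ ha, norm_mul, hc, one_mul]
  have hmult : ∀ ζ : ball (0 : ℂ) 1,
      multAtInfinity (f ∘ α) ζ = m ⟨α ζ, hα.2.mapsTo ζ.2⟩ := fun ζ => by
    have haζ := hα.2.mapsTo ζ.2
    rw [(hG.comp hα.1 hα.2.mapsTo).multAtInfinity_eq isOpen_ball ζ.2]
    have h1 := analyticOrderAt_comp_of_deriv_ne_zero (f := fun z => G z 0)
      (hα.1.analyticAt (isOpen_ball.mem_nhds ζ.2)) (hα.deriv_ne_zero ζ.2)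
    refine h1.trans ?_
    have h2 : (fun z => G z 0) =ᶠ[𝓝 (α ζ)] (fun _ => c) * blaschkeProduct m := by
      filter_upwards [isOpen_ball.mem_nhds haζ] with z hz using hB z hz
    rw [analyticOrderAt_congr h2, analyticOrderAt_mul analyticAt_const
      ((differentiableOn_blaschkeProduct hm).analyticAt (isOpen_ball.mem_nhds haζ)),
      analyticAt_const.analyticOrderAt_eq_zero.2 hc0, zero_add]
    exact analyticOrderAt_blaschkeProduct hm ⟨α ζ, haζ⟩
  let t : ball (0 : ℂ) 1 → ℝ := fun a => (m a : ℝ) * -Real.log ‖blaschkeFactor a (α 0)‖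
  have ht0 : ∀ a, 0 ≤ t a := fun a => mul_nonneg (Nat.cast_nonneg _) (neg_nonneg.2
    (Real.log_nonpos (norm_nonneg _) (norm_blaschkeFactor_lt_one (mem_ball_zero_iff.1 a.2)
      (mem_ball_zero_iff.1 ha)).le))
  have hterm : ∀ ζ : ball (0 : ℂ) 1, (multAtInfinity (f ∘ α) ζ : ℝ≥0∞) *
      (-ENNReal.log ‖(ζ : ℂ)‖ₑ).toENNReal = ENNReal.ofReal (t (hα.2.equiv α ζ)) := fun ζ => by
    have he : hα.2.equiv α ζ = ⟨α ζ, hα.2.mapsTo ζ.2⟩ := rfl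
    have hn : ‖blaschkeFactor (α ζ) (α 0)‖ = ‖(ζ : ℂ)‖ := by
      rw [norm_blaschkeFactor_comm, hα.norm_blaschkeFactor ζ.2]
    rw [hmult ζ, he]
    simp only [t, hn, ENat.toENNReal_coe]
    rw [ENNReal.ofReal_mul (Nat.cast_nonneg _), ENNReal.ofReal_natCast]
    -- At the centre the weight is `∞` in `J` but `-log 0 = 0` in `t`. They agree because `B (α 0) ≠
    -- 0` forces multiplicity zero there.
    by_cases hζ : (ζ : ℂ) = 0
    · have h1 : m ⟨α ζ, hα.2.mapsTo ζ.2⟩ = 0 := by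
        by_contra h2
        refine hB0 ?_
        have h3 : blaschkeFactor (α ζ) (α 0) = 0 := by
          rw [← norm_eq_zero, hn, hζ, norm_zero]
        rw [blaschkeProduct_eq_mul hm ⟨α ζ, hα.2.mapsTo ζ.2⟩ ha, h3, zero_pow h2, zero_mul]
      rw [h1]
      simp
    · rw [toENNReal_neg_log_enorm hζ]
  have hsum := hasSum_neg_log_blaschkeProduct hm ha hB0
  have hJ : J (f ∘ α) = ENNReal.ofReal (-Real.log ‖G (α 0) 0‖) := by
    rw [J, tsum_congr hterm, (hα.2.equiv α).tsum_eq (fun a => ENNReal.ofReal (t a)),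
      ← ENNReal.ofReal_tsum_of_nonneg ht0 hsum.summable, hsum.tsum_eq, hnorm]
  rw [hJ, EReal.coe_ennreal_ofReal, max_eq_left]
  rw [hnorm]
  exact neg_nonneg.2 (Real.log_nonpos (norm_nonneg _) (norm_blaschkeProduct_le_one hm ha))

end DiscFormula

namespace DiscFormula

open MeasureTheory Metric Set Filter Topology

/-! ### Liftings whose zeroth component is a Blaschke product -/

theorem exists_analytic_quotient {U : Set ℂ} (hU : IsOpen U) {f g : ℂ → ℂ}
    (hf : DifferentiableOn ℂ f U) (hg : DifferentiableOn ℂ g U)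
    (hord : ∀ z ∈ U, analyticOrderAt f z = analyticOrderAt g z)
    (hfin : ∀ z ∈ U, analyticOrderAt f z ≠ ⊤) :
    ∃ E : ℂ → ℂ, DifferentiableOn ℂ E U ∧ ∀ z ∈ U, E z ≠ 0 ∧ f z = g z * E z := by
  -- Punctured limits define the quotient globally, including at common zeros; near each point it is
  -- the quotient of the zero-free cofactors.
  let E : ℂ → ℂ := fun z => limUnder (𝓝[≠] z) fun y => f y / g y
  have key : ∀ w ∈ U, ∃ h : ℂ → ℂ, AnalyticAt ℂ h w ∧ h w ≠ 0 ∧ E =ᶠ[𝓝 w] h ∧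
      f w = g w * h w := fun w hw => by
    obtain ⟨k, hk⟩ := ENat.ne_top_iff_exists.1 (hfin w hw)
    have hfw := hf.analyticAt (hU.mem_nhds hw)
    have hgw := hg.analyticAt (hU.mem_nhds hw)
    obtain ⟨φ, hφ, hφ0, hfφ⟩ := hfw.analyticOrderAt_eq_natCast.1 hk.symm
    obtain ⟨ψ, hψ, hψ0, hgψ⟩ := hgw.analyticOrderAt_eq_natCast.1 (hk.trans (hord w hw)).symm
    have hh : AnalyticAt ℂ (fun z => φ z / ψ z) w := hφ.div hψ hψ0
    refine ⟨fun z => φ z / ψ z, hh, div_ne_zero hφ0 hψ0, ?_, ?_⟩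
    · have h1 : ∀ᶠ y in 𝓝 w, y ≠ w → f y / g y = φ y / ψ y := by
        filter_upwards [hfφ, hgψ] with y h1 h2 hy
        rw [h1, h2, smul_eq_mul, smul_eq_mul,
          mul_div_mul_left _ _ (pow_ne_zero _ (sub_ne_zero.2 hy))]
      filter_upwards [h1.eventually_nhds, hh.eventually_analyticAt] with z h2 h3
      refine Tendsto.limUnder_eq ?_
      refine (h3.continuousAt.tendsto.mono_left nhdsWithin_le_nhds).congr' ?_
      have h4 : ∀ᶠ y in 𝓝[≠] z, y ≠ w := by
        by_cases hzw : z = w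
        · rw [hzw]
          exact self_mem_nhdsWithin
        · exact nhdsWithin_le_nhds (eventually_ne_nhds hzw)
      filter_upwards [h4, nhdsWithin_le_nhds h2] with y h5 h6 using (h6 h5).symm
    · rw [hfφ.self_of_nhds, hgψ.self_of_nhds, smul_eq_mul, smul_eq_mul, mul_assoc,
        mul_div_cancel₀ _ hψ0]
  refine ⟨E, fun w hw => ?_, fun w hw => ?_⟩
  · obtain ⟨h, h1, -, h2, -⟩ := key w hw
    exact (h1.congr h2.symm).differentiableAt.differentiableWithinAt
  · obtain ⟨h, -, h1, h2, h3⟩ := key w hw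
    rw [h2.self_of_nhds]
    exact ⟨h1, h3⟩

variable {n : ℕ} {f : ℂ → ℙ ℂ (Fin (n + 1) → ℂ)}

theorem multAtInfinity_ne_top (hJ : J f < ⊤) {ζ : ℂ} (hζ : ζ ∈ ball (0 : ℂ) 1) :
    multAtInfinity f ζ ≠ ⊤ := fun h => by
  have h1 := ENNReal.ne_top_of_tsum_ne_top hJ.ne ⟨ζ, hζ⟩
  simp only [h, ENat.toENNReal_top] at h1
  refine h1 (ENNReal.top_mul (ne_of_gt (lt_of_lt_of_le ?_ (ofReal_one_sub_norm_le ζ))))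
  simpa using hζ

theorem summable_multAtInfinity (hJ : J f < ⊤) :
    Summable fun a : ball (0 : ℂ) 1 => ((multAtInfinity f a).toNat : ℝ) * (1 - ‖(a : ℂ)‖) := by
  have h0 : ∀ a : ball (0 : ℂ) 1, 0 ≤ 1 - ‖(a : ℂ)‖ := fun a => by
    linarith [mem_ball_zero_iff.1 a.2]
  have h1 : ∑' a : ball (0 : ℂ) 1,
      ENNReal.ofReal (((multAtInfinity f a).toNat : ℝ) * (1 - ‖(a : ℂ)‖)) ≠ ⊤ := by
    refine ne_top_of_le_ne_top hJ.ne (ENNReal.tsum_le_tsum fun a => ?_)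
    rw [ENNReal.ofReal_mul (Nat.cast_nonneg _), ENNReal.ofReal_natCast]
    refine mul_le_mul' (le_of_eq ?_) (ofReal_one_sub_norm_le a)
    rw [← ENat.toENNReal_coe, ENat.natCast_toNat (multAtInfinity_ne_top hJ a.2)]
  refine (ENNReal.summable_toReal h1).congr fun a => ?_
  rw [ENNReal.toReal_ofReal (mul_nonneg (Nat.cast_nonneg _) (h0 a))]

/-- The zeroth component of a lifting can be made a Blaschke product. -/
theorem exists_blaschke_lifting (hJ : J f < ⊤) {F : ℂ → Fin (n + 1) → ℂ}
    (hF : IsLiftingOn (ball 0 1) F f) :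
    ∃ E : ℂ → ℂ, (∀ z ∈ ball (0 : ℂ) 1, E z ≠ 0) ∧
      IsLiftingOn (ball 0 1) (fun z => (E z)⁻¹ • F z) f ∧
      ∀ z ∈ ball (0 : ℂ) 1, ((E z)⁻¹ • F z) 0 =
        blaschkeProduct (fun a => (multAtInfinity f a).toNat) z := by
  have hm := summable_multAtInfinity hJ
  obtain ⟨E, hE, hE0⟩ := exists_analytic_quotient isOpen_ball (differentiableOn_pi.1 hF.1 0)
    (differentiableOn_blaschkeProduct hm) (fun z hz => by
      have := analyticOrderAt_blaschkeProduct hm ⟨z, hz⟩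
      rw [ENat.natCast_toNat (multAtInfinity_ne_top hJ hz)] at this
      rw [this, hF.multAtInfinity_eq isOpen_ball hz]) (fun z hz => by
      rw [← hF.multAtInfinity_eq isOpen_ball hz]
      exact multAtInfinity_ne_top hJ hz)
  refine ⟨E, fun z hz => (hE0 z hz).1, ⟨(hE.inv fun z hz => (hE0 z hz).1).smul hF.1,
    fun z hz => ?_⟩, fun z hz => ?_⟩
  · obtain ⟨h1, h2⟩ := hF.2 z hz
    have h3 : (E z)⁻¹ ≠ 0 := inv_ne_zero (hE0 z hz).1
    refine ⟨smul_ne_zero h3 h1, h2.trans ?_⟩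
    rw [Projectivization.mk_eq_mk_iff']
    exact ⟨E z, smul_inv_smul₀ (hE0 z hz).1 _⟩
  · rw [Pi.smul_apply, smul_eq_mul, (hE0 z hz).2, mul_comm, mul_assoc,
      mul_inv_cancel₀ (hE0 z hz).1, mul_one]

/-! ### Affine coordinates -/

/-- The vector of all but the zeroth component, as a point of `ℂⁿ`. -/
noncomputable def tailVec (v : Fin (n + 1) → ℂ) : EuclideanSpace ℂ (Fin n) :=
  WithLp.toLp 2 fun j => v j.succ

theorem continuous_tailVec : Continuous (tailVec (n := n)) :=
  (PiLp.continuous_toLp 2 _).comp (by fun_prop)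

theorem tailVec_smul (c : ℂ) (v : Fin (n + 1) → ℂ) : tailVec (c • v) = c • tailVec v := rfl

theorem mk_eq_affinePoint_iff {v : Fin (n + 1) → ℂ} (hv : v ≠ 0) (x : EuclideanSpace ℂ (Fin n)) :
    Projectivization.mk ℂ v hv = affinePoint x ↔ v 0 ≠ 0 ∧ (v 0)⁻¹ • tailVec v = x := by
  constructor
  · intro h
    have h1 : ∀ i, v i = homogenize x i * v 0 := fun i => by
      simpa [homogenize] using mk_eq_mk_mul_eq h i 0
    have h0 : v 0 ≠ 0 := fun h0 => hv (funext fun i => by rw [h1 i, h0, mul_zero]; rfl)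
    refine ⟨h0, ?_⟩
    ext j
    have := h1 j.succ
    simp only [homogenize, Fin.cons_succ] at this
    simp only [tailVec, PiLp.smul_apply, smul_eq_mul, this]
    field_simp
  · rintro ⟨h0, rfl⟩
    refine (Projectivization.mk_eq_mk_iff' ℂ _ _ _ _).2 ⟨v 0, ?_⟩
    ext i
    refine Fin.cases ?_ (fun j => ?_) i
    · simp [homogenize]
    · simp [homogenize, tailVec, h0]

theorem differentiableOn_tailVec {U : Set ℂ} {G : ℂ → Fin (n + 1) → ℂ}
    (hG : DifferentiableOn ℂ G U) : DifferentiableOn ℂ (fun z => tailVec (G z)) U :=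
  (PiLp.continuousLinearEquiv 2 ℂ fun _ : Fin n => ℂ).symm.differentiable.comp_differentiableOn
    (differentiableOn_pi.2 fun j => differentiableOn_pi.1 hG j.succ)

/-- On the radius `|ζ - r ζ| = 1 - r`, so any aperture above `1` would do. -/
theorem tendsto_mul_approachRegion {ζ : ℂ} (hζ : ζ ∈ sphere (0 : ℂ) 1) :
    Tendsto (fun r : ℝ => (r : ℂ) * ζ) (𝓝[<] 1) (𝓝[approachRegion ζ 2] ζ) := by
  have hζ' : ‖ζ‖ = 1 := by simpa using hζ
  refine tendsto_nhdsWithin_iff.2 ⟨?_, ?_⟩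
  · have : ContinuousAt (fun r : ℝ => (r : ℂ) * ζ) 1 := by fun_prop
    simpa [ContinuousAt] using this.tendsto.mono_left nhdsWithin_le_nhds
  · filter_upwards [Ioo_mem_nhdsLT (show (0 : ℝ) < 1 by norm_num)] with r hr
    have h1 : ‖(r : ℂ) * ζ‖ = r := by
      rw [norm_mul, hζ', Complex.norm_real, Real.norm_of_nonneg hr.1.le, mul_one]
    have h2 : ‖ζ - r * ζ‖ = 1 - r := by
      rw [show ζ - r * ζ = ((1 - r : ℝ) : ℂ) * ζ by push_cast; ring, norm_mul, hζ',
        Complex.norm_real, Real.norm_of_nonneg (by linarith [hr.2]), mul_one]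
    refine ⟨by rw [h1]; exact hr.2, ?_⟩
    rw [h1, h2]
    linarith [hr.2]

theorem HasBoundaryValuesIn.radial {F : ℂ → Fin (n + 1) → ℂ} {X : Set (EuclideanSpace ℂ (Fin n))}
    (h : HasBoundaryValuesIn F X) : ∀ᵐ ζ ∂arcLength, ∃ x ∈ X,
      (∀ᶠ r : ℝ in 𝓝[<] 1, F (r * ζ) 0 ≠ 0) ∧
      Tendsto (fun r : ℝ => (F (r * ζ) 0)⁻¹ • tailVec (F (r * ζ))) (𝓝[<] 1) (𝓝 x) := by
  filter_upwards [h, arcLength_ae_mem_sphere] with ζ ⟨w, hw, hw0, x, hx, hwx⟩ hζ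
  obtain ⟨h0, hx'⟩ := (mk_eq_affinePoint_iff hw0 x).1 hwx
  have hlim : Tendsto (fun r : ℝ => F (r * ζ)) (𝓝[<] 1) (𝓝 w) :=
    tendsto_pi_nhds.2 fun j => (hw j 2 (by norm_num)).comp (tendsto_mul_approachRegion hζ)
  have hlim0 := tendsto_pi_nhds.1 hlim 0
  refine ⟨x, hx, hlim0.eventually_ne h0, ?_⟩
  rw [← hx']
  exact (hlim0.inv₀ h0).smul ((continuous_tailVec.tendsto w).comp hlim)

end DiscFormula

/-! ### The equivalence -/

open DiscFormula in
theorem proposition2p1 (n : ℕ) (X : Set (EuclideanSpace ℂ (Fin n)))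
    (hX_ne : X.Nonempty) (hX_bdd : Bornology.IsBounded X) (hX_open : IsOpen X)
    (f : ℂ → Projectivization ℂ (Fin (n + 1) → ℂ)) (hf : IsAnalyticDisc f) (hJ : J f < ⊤)
    (hbv : ∃ F : ℂ → Fin (n + 1) → ℂ,
      IsLiftingOn (Metric.ball 0 1) F f ∧ HasBoundaryValuesIn F X) :
    (∀ α : ℂ → ℂ, IsDiscAut α → ∀ z : EuclideanSpace ℂ (Fin n), f (α 0) = affinePoint z →
        extremalFunction X z ≤ (J (f ∘ α) : EReal)) ↔
      (∀ G : ℂ → Fin (n + 1) → ℂ, IsLiftingOn (Metric.ball 0 1) G f →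
        IsBlaschkeProduct (fun z => G z 0) →
          ∀ j : Fin n, ∃ C : ℝ, ∀ z ∈ Metric.ball (0 : ℂ) 1, ‖G z j.succ‖ ≤ C) := by
  constructor
  · rintro h G hG ⟨c, m, hc, hm, hB⟩ j
    have hB' : ∀ z ∈ Metric.ball (0 : ℂ) 1, G z 0 = c * blaschkeProduct m z := fun z hz => by
      obtain ⟨p, hp, hGp⟩ := hB z hz
      refine hGp.trans ?_
      rw [hp.unique (hasProd_blaschkeProduct hm hz)]
    obtain ⟨R₀, hR₀⟩ := hX_bdd.exists_norm_le
    set R := max 1 R₀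
    have hR : 1 ≤ R := le_max_left _ _
    have hR0 : 0 < R := by linarith
    have hXR : ∀ x ∈ X, ‖x‖ ≤ R := fun x hx => (hR₀ x hx).trans (le_max_right _ _)
    have hGR : ∀ z ∈ Metric.ball (0 : ℂ) 1, G z 0 ≠ 0 → ‖tailVec (G z)‖ ≤ R := fun z hz h0 => by
      -- The involution of `z` takes `0` to `z`, so (i) becomes a statement at `z`.
      have hα := isDiscAut_discInvolution (mem_ball_zero_iff.1 hz)
      have hα0 : discInvolution z 0 = z := by simp [discInvolution]
      obtain ⟨h1, h2⟩ := hG.2 z hz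
      have h3 := h _ hα ((G z 0)⁻¹ • tailVec (G z)) (by
        rw [hα0, h2]
        exact (mk_eq_affinePoint_iff h1 _).2 ⟨h0, rfl⟩)
      rw [J_comp_eq_neg_log hG hc hm hB' hα (by rwa [hα0]), hα0] at h3
      have h4 := (posLog_le_extremalFunction hR hXR _).trans h3
      rw [EReal.coe_le_coe_iff] at h4
      by_cases hv : tailVec (G z) = 0
      · rw [hv, norm_zero]
        exact hR0.le
      have h5 := (le_max_right _ _).trans h4
      have hv' : 0 < ‖tailVec (G z)‖ := norm_pos_iff.2 hv
      have h0' : 0 < ‖G z 0‖ := norm_pos_iff.2 h0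
      rw [norm_smul, norm_inv, Real.log_mul (by positivity) (by positivity),
        Real.log_mul (by positivity) (by positivity), Real.log_inv, Real.log_inv] at h5
      exact (Real.log_le_log_iff hv' hR0).1 (by linarith)
    -- Zeros of the Blaschke product are isolated, so the bound passes to them by continuity.
    have hGR' : ∀ z ∈ Metric.ball (0 : ℂ) 1, ‖tailVec (G z)‖ ≤ R := fun z hz => by
      have hn := Metric.isOpen_ball.mem_nhds hz
      have hc0 : c ≠ 0 := norm_ne_zero_iff.1 (by rw [hc]; exact one_ne_zero)
      have han := (differentiableOn_blaschkeProduct hm).analyticAt hn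
      have hne : ∀ᶠ y in nhdsWithin z {z}ᶜ, blaschkeProduct m y ≠ 0 := by
        refine han.eventually_eq_zero_or_eventually_ne_zero.resolve_left fun h0 => ?_
        have := analyticOrderAt_blaschkeProduct hm ⟨z, hz⟩
        rw [analyticOrderAt_eq_top.2 h0] at this
        exact ENat.top_ne_natCast _ this
      have hcont : ContinuousAt (fun y => ‖tailVec (G y)‖) z :=
        ((differentiableOn_tailVec hG.1).differentiableAt hn).continuousAt.norm
      refine le_of_tendsto (hcont.tendsto.mono_left (nhdsWithin_le_nhds (s := {z}ᶜ))) ?_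
      filter_upwards [hne, nhdsWithin_le_nhds hn] with y hy hyb
      exact hGR y hyb (by rw [hB' y hyb]; exact mul_ne_zero hc0 hy)
    exact ⟨R, fun z hz => (PiLp.norm_apply_le (tailVec (G z)) j).trans (hGR' z hz)⟩
  · intro h α hα z hz
    obtain ⟨F, hF, hFX⟩ := hbv
    obtain ⟨E, hE0, hG, hB⟩ := exists_blaschke_lifting hJ hF
    have hm := summable_multAtInfinity hJ
    choose C hC using h _ hG ⟨1, _, norm_one, hm, fun z hz =>
      ⟨_, hasProd_blaschkeProduct hm hz, by rw [one_mul]; exact hB z hz⟩⟩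
    have ha : α 0 ∈ Metric.ball (0 : ℂ) 1 := hα.2.mapsTo (by simp)
    set G : ℂ → Fin (n + 1) → ℂ := fun z => (E z)⁻¹ • F z with hGdef
    obtain ⟨h1, h2⟩ := hG.2 _ ha
    obtain ⟨h0, hz'⟩ := (mk_eq_affinePoint_iff h1 z).1 (h2.symm.trans hz)
    rw [J_comp_eq_neg_log hG norm_one hm (fun z hz => by rw [one_mul]; exact hB z hz) hα h0,
      ← hz']
    refine iSup₂_le fun u hu => ?_
    refine lelongClass_le_neg_log hu.1 hX_open hu.2 (B := fun z => G z 0)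
      (g := fun z => tailVec (G z)) (differentiableOn_pi.1 hG.1 0)
      (fun w hw => (congrArg norm (hB w hw)).trans_le (norm_blaschkeProduct_le_one hm hw))
      (differentiableOn_tailVec hG.1) (G := Real.sqrt (∑ j, C j ^ 2)) (fun w hw => ?_) ?_ ha h0
    · rw [EuclideanSpace.norm_eq]
      exact Real.sqrt_le_sqrt (Finset.sum_le_sum fun j _ =>
        pow_le_pow_left₀ (norm_nonneg _) (hC j w hw) 2)
    · filter_upwards [hFX.radial, arcLength_ae_mem_sphere] with ζ ⟨x, hx, h3, h4⟩ hζ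
      have hEr : ∀ᶠ r : ℝ in nhdsWithin 1 (Set.Iio 1), E (r * ζ) ≠ 0 := by
        filter_upwards [(tendsto_mul_approachRegion hζ).eventually self_mem_nhdsWithin] with r hr
        exact hE0 _ (mem_ball_zero_iff.2 hr.1)
      refine ⟨x, hx, ?_, h4.congr' ?_⟩
      · filter_upwards [h3, hEr] with r h5 h6
        exact mul_ne_zero (inv_ne_zero h6) h5
      -- `E` cancels in the affine coordinates, so its own boundary behaviour is irrelevant.
      · filter_upwards [hEr] with r h6
        simp only [hGdef, tailVec_smul, Pi.smul_apply, smul_eq_mul, mul_inv, inv_inv, smul_smul]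
        rw [mul_comm (E _), mul_assoc, mul_inv_cancel₀ h6, mul_one]
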